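/- **Setting.** Let $\Omega$ be a set and $\mathcal H$ a linear space of real functions on $\Omega$ such that $\varphi(X_1,\dots,X_n)\in\mathcal H$ whenever $X_1,\dots,X_n\in\mathcal H$ and $\varphi:\mathbb R^n\to\mathbb R$ is Lipschitz. Let $\hat{\mathbb E}:\mathcal H\to\mathbb R$ be a sublinear expectation: for $X,Y\in\mathcal H$, $\hat{\mathbb E}[X]\ge\hat{\mathbb E}[Y]$ if $X\ge Y$; $\hat{\mathbb E}[c]=c$ for constants $c\in\mathbb R$; $\hat{\mathbb E}[X]-\hat{\mathbb E}[Y]\le\hat{\mathbb E}[X-Y]$; and $\hat{\mathbb E}[\lambda X]=\lambda\hat{\mathbb E}[X]$ for $\lambda\ge 0$. Random vectors $X,Y\in\mathcal H^n$ have the same distribution if $\hat{\mathbb E}[\varphi(X)]=\hat{\mathbb E}[\varphi(Y)]$ for all Lipschitz $\varphi$, and $Y\in\mathcal H^n$ is independent from $X\in\mathcal H^m$ if $\hat{\mathbb E}[\varphi(X,Y)]=\hat{\mathbb E}\big[\hat{\mathbb E}[\varphi(x,Y)]_{x=X}\big]$ for all Lipschitz $\varphi$ on $\mathbb R^m\times\mathbb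 R^n$. An $n$-dimensional Lévy process is a family $(X_t)_{t\ge0}$ in $\mathcal H^n$ with càdlàg paths such that $X_0=0$; for all $t,s>0$ and $0\le t_1\le\dots\le t_k\le t$ the increment $X_{t+s}-X_t$ is independent from $(X_{t_1},\dots,X_{t_k})$; and the distribution of $X_{t+s}-X_t$ does not depend on $t$. A $d$-dimensional $G$-Lévy process is a $d$-dimensional Lévy process $(X_t)_{t\ge0}$ with a decomposition $X_t=X^c_t+X^d_t$ for all $t\ge 0$ such that $(X^c_t,X^d_t)_{t\ge0}$ is a $2d$-dimensional Lévy process and $$\lim_{t\downarrow0}\hat{\mathbb E}[|X^c_t|^3]\,t^{-1}=0,\qquad \hat{\mathbb E}[|X^d_t|]\le Ct\quad\text{for all } t\ge0,$$ for some constant $C$ (where it is understood that $|X^c_t|^3\in\mathcal H$ for small $t>0$). Let $C_b^3(\mathbb R^d)$ be the space of three times continuously differentiable functions on $\mathbb R^d$ that are bounded together with all derivatives of order at most $3$. **Theorem (Lévy–Khintchine representation of $G_X$).** Let $(X_t)_{t\ge0}$ be a $d$-dimensional $G$-Lévy process. Then there is a set $\mathcal U$ of triples $(v,q,Q)$, where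 $v$ is a measure on the Borel $\sigma$-algebra of $\mathbb R^d\setminus\{0\}$, $q\in\mathbb R^d$ and $Q\in\mathbb R^{d\times d}$, such that $$\sup_{(v,q,Q)\in\mathcal U}\Big\{\int_{\mathbb R^d\setminus\{0\}}|z|\,v(dz)+|q|+\operatorname{tr}[QQ^T]\Big\}<\infty$$ and such that, for every $f\in C_b^3(\mathbb R^d)$ with $f(0)=0$, the function $f$ is $v$-integrable for every $(v,q,Q)\in\mathcal U$, the limit $G_X[f(\cdot)]:=\lim_{\delta\downarrow0}\hat{\mathbb E}[f(X_\delta)]\,\delta^{-1}$ exists in $\mathbb R$, and $$G_X[f(\cdot)]=\sup_{(v,q,Q)\in\mathcal U}\Big\{\int_{\mathbb R^d\setminus\{0\}}f(z)\,v(dz)+\langle Df(0),q\rangle+\tfrac12\operatorname{tr}[D^2f(0)QQ^T]\Big\}.$$ -/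

import Mathlib

open Filter Topology MeasureTheory
open scoped NNReal ENNReal

namespace GLevy

/-- A sublinear expectation space `(Ω, H, E)`: `H` is a linear space of real functions on `Ω`,
stable under composition with Lipschitz functions of finitely many variables (so it contains the
constants), and `E` is a sublinear expectation on `H`. The functional `E` is only meaningful on
`H`: its values outside `H` are arbitrary, and no property of them is assumed. -/
structure SublinearExpectationSpace (Ω : Type*) where
  H : Submodule ℝ (Ω → ℝ)
  lipschitz_comp_mem : ∀ (n : ℕ) (X : Fin n → Ω → ℝ), (∀ i, X i ∈ H) →
    ∀ φ : (Fin n → ℝ) → ℝ, (∃ K : ℝ≥0, LipschitzWith K φ) →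
      (fun ω => φ (fun i => X i ω)) ∈ H
  E : (Ω → ℝ) → ℝ
  mono : ∀ X ∈ H, ∀ Y ∈ H, (∀ ω, Y ω ≤ X ω) → E Y ≤ E X
  const : ∀ c : ℝ, E (fun _ => c) = c
  subadd : ∀ X ∈ H, ∀ Y ∈ H, E X - E Y ≤ E (X - Y)
  pos_homog : ∀ X ∈ H, ∀ r : ℝ, 0 ≤ r → E (r • X) = r * E X

variable {Ω : Type*} (S : SublinearExpectationSpace Ω)

section Vectors

variable {V W : Type*} [NormedAddCommGroup V] [NormedSpace ℝ V]
  [NormedAddCommGroup W] [NormedSpace ℝ W]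

/-- `X` is a random vector with values in the (finite-dimensional) space `V`: all its coordinates,
equivalently all linear functionals of it, belong to `H`. -/
def IsRandomVector (X : Ω → V) : Prop :=
  ∀ l : V →L[ℝ] ℝ, (fun ω => l (X ω)) ∈ S.H

/-- Random vectors with the same distribution: `E[φ(X)] = E[φ(Y)]` for all Lipschitz `φ`. -/
def SameDistribution (X Y : Ω → V) : Prop :=
  ∀ φ : V → ℝ, (∃ K : ℝ≥0, LipschitzWith K φ) →
    S.E (fun ω => φ (X ω)) = S.E (fun ω => φ (Y ω))

/-- `Y` is independent from `X` (in this order): `E[φ(X, Y)] = E[E[φ(x, Y)]_{x = X}]` for all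
Lipschitz `φ`. -/
def IndependentFrom (Y : Ω → W) (X : Ω → V) : Prop :=
  ∀ φ : V × W → ℝ, (∃ K : ℝ≥0, LipschitzWith K φ) →
    S.E (fun ω => φ (X ω, Y ω)) = S.E (fun ω => S.E (fun ω' => φ (X ω, Y ω')))

/-- Right-continuous with left limits. -/
def IsCadlag (x : ℝ≥0 → V) : Prop :=
  ∀ t, Tendsto x (𝓝[>] t) (𝓝 (x t)) ∧ ∃ l, Tendsto x (𝓝[<] t) (𝓝 l)

/-- Lévy processes under the sublinear expectation, with values in a finite-dimensional space. -/
structure IsLevyProcess [FiniteDimensional ℝ V] (X : ℝ≥0 → Ω → V) : Prop where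
  isRandomVector : ∀ t, IsRandomVector S (X t)
  cadlag : ∀ ω, IsCadlag (fun t => X t ω)
  zero : ∀ ω, X 0 ω = 0
  indep_increments : ∀ t s : ℝ≥0, 0 < t → 0 < s → ∀ (n : ℕ) (τ : Fin n → ℝ≥0),
    Monotone τ → (∀ i, τ i ≤ t) →
      IndependentFrom S (fun ω => X (t + s) ω - X t ω) (fun ω i => X (τ i) ω)
  stationary_increments : ∀ s t t' : ℝ≥0,
    SameDistribution S (fun ω => X (t + s) ω - X t ω) (fun ω => X (t' + s) ω - X t' ω)

end Vectors

/-- A `d`-dimensional `G`-Lévy process: a Lévy process `X = Xᶜ + Xᵈ`, where `(Xᶜ, Xᵈ)` is a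
`2d`-dimensional Lévy process such that `E[|Xᶜ_t|³] / t → 0` as `t ↓ 0` (in particular `|Xᶜ_t|³`
lies in the domain of `E` for small `t`) and `E[|Xᵈ_t|] ≤ C t` for all `t`. -/
def IsGLevyProcess {d : ℕ} (X : ℝ≥0 → Ω → EuclideanSpace ℝ (Fin d)) : Prop :=
  IsLevyProcess S X ∧
  ∃ Xc Xd : ℝ≥0 → Ω → EuclideanSpace ℝ (Fin d),
    (∀ t ω, X t ω = Xc t ω + Xd t ω) ∧
    IsLevyProcess S (fun t ω => (Xc t ω, Xd t ω)) ∧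
    (∀ᶠ t in 𝓝[>] (0 : ℝ≥0), (fun ω => ‖Xc t ω‖ ^ 3) ∈ S.H) ∧
    Tendsto (fun t : ℝ≥0 => S.E (fun ω => ‖Xc t ω‖ ^ 3) / (t : ℝ)) (𝓝[>] 0) (𝓝 0) ∧
    ∃ C : ℝ, ∀ t : ℝ≥0, S.E (fun ω => ‖Xd t ω‖) ≤ C * t

/-- The class `C_b^k`: `f` is `k` times continuously differentiable, and `f` and its derivatives
of order at most `k` are bounded. -/
def IsCb {d : ℕ} (k : ℕ) (f : EuclideanSpace ℝ (Fin d) → ℝ) : Prop :=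
  ContDiff ℝ k f ∧ ∀ j ≤ k, ∃ C : ℝ, ∀ x, ‖iteratedFDeriv ℝ j f x‖ ≤ C

/-- The Hessian matrix `D²f(x)`. -/
noncomputable def hessian {d : ℕ} (f : EuclideanSpace ℝ (Fin d) → ℝ)
    (x : EuclideanSpace ℝ (Fin d)) : Matrix (Fin d) (Fin d) ℝ :=
  Matrix.of fun i j =>
    fderiv ℝ (fderiv ℝ f) x (EuclideanSpace.single i 1) (EuclideanSpace.single j 1)

/-- Triples `(v, q, Q)`. A measure on `ℝᵈ \ {0}` is represented by the measure on `ℝᵈ` that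
extends it by `v {0} = 0`. -/
structure LevyTriple (d : ℕ) where
  v : Measure (EuclideanSpace ℝ (Fin d))
  v_zero : v {0} = 0
  q : EuclideanSpace ℝ (Fin d)
  Q : Matrix (Fin d) (Fin d) ℝ

/-- `∫ f(z) v(dz) + ⟨Df(0), q⟩ + ½ tr[D²f(0) Q Qᵀ]`. -/
noncomputable def LevyTriple.apply {d : ℕ} (u : LevyTriple d)
    (f : EuclideanSpace ℝ (Fin d) → ℝ) : ℝ :=
  (∫ z, f z ∂u.v) + inner ℝ (gradient f 0) u.q
    + (1 / 2) * (hessian f 0 * (u.Q * u.Q.transpose)).trace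

/-- `∫ |z| v(dz) + |q| + tr[Q Qᵀ]`, with values in `[0, ∞]`. -/
noncomputable def LevyTriple.size {d : ℕ} (u : LevyTriple d) : ℝ≥0∞ :=
  (∫⁻ z, ‖z‖ₑ ∂u.v) + ‖u.q‖ₑ + ENNReal.ofReal (u.Q * u.Q.transpose).trace

end GLevy

/-! The set `U` consists of all triples of size at most a fixed `B` that are dominated by `G_X`.
Domination gives the upper bound for free, so the work lies in showing that for each `f₀` some
triple in `U` attains `G_X[f₀]`.

Small-time estimates come from the semigroup identity `E_comp_add`. A function that is bounded above
and nearly superadditive in time is `O(t)`; applied to linear functionals and to `1 - cos` of the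
continuous part, this controls drift and variance. Hence `exists_E_le`: functions of the form linear
plus quadratic in `Xᶜ` plus linear growth in `Xᵈ` have expectation `O(t)`. Applied to `f(x + z) -
f(x) - f(z)`, the bound makes `t ↦ E[f(X_t)]` almost additive, so it has a derivative at `0`
(`exists_tendsto`).

For the representation, `exists_linearMap_le_rate` uses Hahn-Banach to produce a linear `F` below
the upper rate with `F f₀ = G_X[f₀]`. Domination makes `F` positive. Riesz' theorem applied to `g ↦
F (weight * g)`, followed by division by the weight away from `0`, gives a measure `v` that
represents `F` on functions of order `|z|³ ∧ 1`. What `v` misses in first and second order at the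
origin is the vector `q` and a positive semidefinite matrix `Q Qᵀ` (`exists_levyTriple`).

The size bound is uniform because `E[|Xᶜ_t|³] = o(t)`: the functions `(|z| - ε)⁺` have a rate
bounded independently of `ε`, since only jumps contribute to it. Letting `ε → 0` bounds `∫ |z| dv`.
-/

namespace GLevy

variable {Ω : Type*} {S : SublinearExpectationSpace Ω}

/-! ### Sublinear expectations and the semigroup of a Lévy process. -/

namespace SublinearExpectationSpace

lemma const_mem (S : SublinearExpectationSpace Ω) (c : ℝ) : (fun _ : Ω => c) ∈ S.H :=
  S.lipschitz_comp_mem 0 Fin.elim0 (fun i => i.elim0) (fun _ => c) ⟨0, LipschitzWith.const c⟩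

lemma E_add_le {X Y : Ω → ℝ} (hX : X ∈ S.H) (hY : Y ∈ S.H) :
    S.E (fun ω => X ω + Y ω) ≤ S.E X + S.E Y := by
  have h := S.subadd (X + Y) (S.H.add_mem hX hY) Y hY
  rw [add_sub_cancel_right] at h
  have : S.E (X + Y) = S.E (fun ω => X ω + Y ω) := rfl
  linarith

lemma E_sub_E_le {X Y : Ω → ℝ} (hX : X ∈ S.H) (hY : Y ∈ S.H) :
    S.E X - S.E Y ≤ S.E (fun ω => X ω - Y ω) := S.subadd X hX Y hY

lemma E_const_add {X : Ω → ℝ} (hX : X ∈ S.H) (c : ℝ) :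
    S.E (fun ω => c + X ω) = c + S.E X := by
  apply le_antisymm
  · have := S.E_add_le (S.const_mem c) hX
    rwa [S.const] at this
  · have h2 : (fun ω => c + X ω) ∈ S.H := S.H.add_mem (S.const_mem c) hX
    have := S.E_add_le (S.const_mem (-c)) h2
    rw [S.const] at this
    simp only [neg_add_cancel_left] at this
    linarith

lemma E_const_mul {X : Ω → ℝ} (hX : X ∈ S.H) {c : ℝ} (hc : 0 ≤ c) :
    S.E (fun ω => c * X ω) = c * S.E X := S.pos_homog X hX c hc

lemma E_nonneg {X : Ω → ℝ} (hX : X ∈ S.H) (h : ∀ ω, 0 ≤ X ω) : 0 ≤ S.E X := by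
  have := S.mono X hX (fun _ => 0) (S.const_mem 0) h
  rwa [S.const] at this

lemma neg_E_neg_le {X : Ω → ℝ} (hX : X ∈ S.H) : -S.E (fun ω => -X ω) ≤ S.E X := by
  have hn : (fun ω => -X ω) ∈ S.H := S.H.neg_mem hX
  have := S.E_add_le hX hn
  simp only [add_neg_cancel] at this
  rw [S.const] at this
  linarith

lemma E_sum_le {ι : Type*} (s : Finset ι) {X : ι → Ω → ℝ} (hX : ∀ i ∈ s, X i ∈ S.H) :
    (fun ω => ∑ i ∈ s, X i ω) ∈ S.H ∧ S.E (fun ω => ∑ i ∈ s, X i ω) ≤ ∑ i ∈ s, S.E (X i) := by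
  classical
  induction s using Finset.induction_on with
  | empty => simpa using ⟨S.const_mem 0, (S.const 0).le⟩
  | insert a s ha ih =>
    obtain ⟨h1, h2⟩ := ih fun i hi => hX i (Finset.mem_insert_of_mem hi)
    have h3 := hX a (Finset.mem_insert_self a s)
    simp only [Finset.sum_insert ha]
    exact ⟨S.H.add_mem h3 h1, (S.E_add_le h3 h1).trans (by linarith)⟩

lemma E_le_add_of_le {X Y Z : Ω → ℝ} (hX : X ∈ S.H) (hY : Y ∈ S.H) (hZ : Z ∈ S.H)
    (h : ∀ ω, X ω ≤ Y ω + Z ω) : S.E X ≤ S.E Y + S.E Z :=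
  (S.mono _ (S.H.add_mem hY hZ) _ hX h).trans (S.E_add_le hY hZ)

end SublinearExpectationSpace

lemma IsRandomVector.lipschitz_comp {V : Type*} [NormedAddCommGroup V] [NormedSpace ℝ V]
    [FiniteDimensional ℝ V] {X : Ω → V}
    (hX : IsRandomVector S X) {φ : V → ℝ} (hφ : ∃ K : ℝ≥0, LipschitzWith K φ) :
    (fun ω => φ (X ω)) ∈ S.H := by
  obtain ⟨K, hK⟩ := hφ
  let e : V ≃L[ℝ] (Fin (Module.finrank ℝ V) → ℝ) :=
    ContinuousLinearEquiv.ofFinrankEq (by simp)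
  have h := S.lipschitz_comp_mem _ (fun i ω => e (X ω) i)
    (fun i => hX ((ContinuousLinearMap.proj (R := ℝ) (φ := fun _ => ℝ) i).comp
      (e : V →L[ℝ] (Fin (Module.finrank ℝ V) → ℝ))))
    (φ ∘ e.symm) ⟨_, hK.comp e.symm.lipschitz⟩
  simpa using h

/-- Since `E` is monotone only on `H`, an inner expectation must be shown to be Lipschitz in its
parameter before it can be estimated under an outer one. -/
lemma IsRandomVector.lipschitz_expectation {V W : Type*} [NormedAddCommGroup V]
    [NormedAddCommGroup W] [NormedSpace ℝ W] [FiniteDimensional ℝ W] {Y : Ω → W}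
    (hY : IsRandomVector S Y) {φ : V × W → ℝ} {K : ℝ≥0} (hφ : LipschitzWith K φ) :
    LipschitzWith K (fun x => S.E (fun ω => φ (x, Y ω))) := by
  have hL (x : V) : LipschitzWith K (fun y => φ (x, y)) := by
    have := hφ.comp (LipschitzWith.prodMk_left x)
    rwa [mul_one] at this
  have hmem (x : V) : (fun ω => φ (x, Y ω)) ∈ S.H := hY.lipschitz_comp ⟨K, hL x⟩
  refine LipschitzWith.of_le_add_mul K fun x y => ?_
  rw [add_comm, ← S.E_const_add (hmem y)]
  refine S.mono _ (S.H.add_mem (S.const_mem _) (hmem y)) _ (hmem x) fun ω => ?_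
  have := hφ.dist_le_mul (x, Y ω) (y, Y ω)
  rw [Prod.dist_eq, dist_self, max_eq_left dist_nonneg, Real.dist_eq] at this
  simp only [Pi.add_apply]
  linarith [le_abs_self (φ (x, Y ω) - φ (y, Y ω))]

section Vectors

variable {V : Type*} [NormedAddCommGroup V] [NormedSpace ℝ V]

namespace IsLevyProcess

variable [FiniteDimensional ℝ V] {Z : ℝ≥0 → Ω → V}

lemma comp_mem (hZ : IsLevyProcess S Z) (t : ℝ≥0) {φ : V → ℝ}
    (hφ : ∃ K : ℝ≥0, LipschitzWith K φ) : (fun ω => φ (Z t ω)) ∈ S.H :=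
  (hZ.isRandomVector t).lipschitz_comp hφ

/-- The Markov property in the form of a semigroup identity. -/
lemma E_comp_add (hZ : IsLevyProcess S Z) (t s : ℝ≥0) {φ : V → ℝ}
    (hφ : ∃ K : ℝ≥0, LipschitzWith K φ) :
    S.E (fun ω => φ (Z (t + s) ω)) =
      S.E (fun ω => S.E (fun ω' => φ (Z t ω + Z s ω'))) := by
  obtain ⟨K, hK⟩ := hφ
  -- Independence of increments is assumed only for positive times; the degenerate cases follow from
  -- `Z 0 = 0`.
  rcases eq_or_ne t 0 with rfl | ht
  · simp [hZ.zero, S.const]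
  rcases eq_or_ne s 0 with rfl | hs
  · simp [hZ.zero, S.const]
  have h := hZ.indep_increments t s (pos_iff_ne_zero.2 ht) (pos_iff_ne_zero.2 hs) 1
    (fun _ => t) monotone_const (fun _ => le_rfl) (fun p => φ (p.1 0 + p.2))
    ⟨_, hK.comp (((LipschitzWith.eval (0 : Fin 1)).comp LipschitzWith.prod_fst).add
      LipschitzWith.prod_snd)⟩
  simp only [add_sub_cancel] at h
  rw [h]
  congr 1
  funext ω
  have h2 := hZ.stationary_increments s t 0 (fun y => φ (Z t ω + y))
    ⟨_, hK.comp ((LipschitzWith.const (Z t ω)).add LipschitzWith.id)⟩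
  simpa [hZ.zero] using h2

lemma lipschitz_semigroup (hZ : IsLevyProcess S Z) (s : ℝ≥0) {φ : V → ℝ}
    (hφ : ∃ K : ℝ≥0, LipschitzWith K φ) :
    ∃ K : ℝ≥0, LipschitzWith K (fun x => S.E (fun ω => φ (x + Z s ω))) := by
  obtain ⟨K, hK⟩ := hφ
  exact ⟨_, (hZ.isRandomVector s).lipschitz_expectation (φ := fun p : V × V => φ (p.1 + p.2))
    (hK.comp (LipschitzWith.prod_fst.add LipschitzWith.prod_snd))⟩

lemma E_comp_add_le (hZ : IsLevyProcess S Z) (t s : ℝ≥0) {φ ψ : V → ℝ}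
    (hφ : ∃ K : ℝ≥0, LipschitzWith K φ) (hψ : ∃ K : ℝ≥0, LipschitzWith K ψ)
    (h : ∀ x, S.E (fun ω => φ (x + Z s ω)) ≤ ψ x) :
    S.E (fun ω => φ (Z (t + s) ω)) ≤ S.E (fun ω => ψ (Z t ω)) := by
  rw [hZ.E_comp_add t s hφ]
  exact S.mono _ (hZ.comp_mem t hψ) _ (hZ.comp_mem t (hZ.lipschitz_semigroup s hφ)) fun ω => h _

lemma le_E_comp_add (hZ : IsLevyProcess S Z) (t s : ℝ≥0) {φ ψ : V → ℝ}
    (hφ : ∃ K : ℝ≥0, LipschitzWith K φ) (hψ : ∃ K : ℝ≥0, LipschitzWith K ψ)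
    (h : ∀ x, ψ x ≤ S.E (fun ω => φ (x + Z s ω))) :
    S.E (fun ω => ψ (Z t ω)) ≤ S.E (fun ω => φ (Z (t + s) ω)) := by
  rw [hZ.E_comp_add t s hφ]
  exact S.mono _ (hZ.comp_mem t (hZ.lipschitz_semigroup s hφ)) _ (hZ.comp_mem t hψ) fun ω => h _

lemma translate_mem (hZ : IsLevyProcess S Z) (s : ℝ≥0) (x : V) {φ : V → ℝ}
    (hφ : ∃ K : ℝ≥0, LipschitzWith K φ) : (fun ω => φ (x + Z s ω)) ∈ S.H := by
  obtain ⟨K, hK⟩ := hφ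
  exact hZ.comp_mem s (φ := fun z => φ (x + z))
    ⟨_, hK.comp ((LipschitzWith.const x).add LipschitzWith.id)⟩

end IsLevyProcess

end Vectors

/-! ### Almost additive functions of time, and trigonometric inequalities. -/

section RealFunctions

/-- A function on `[0, t₀]` that is bounded above and almost superadditive is at most linear. -/
lemma exists_le_mul_of_superadditive {a : ℝ≥0 → ℝ} {t₀ : ℝ≥0} {M c C : ℝ} (ht₀ : 0 < t₀)
    (hc : 0 < c) (h0 : 0 ≤ a 0) (hM : ∀ t ≤ t₀, a t ≤ M)
    (h : ∀ t s : ℝ≥0, 0 < s → t + s ≤ t₀ → a t + c * a s - C * s ≤ a (t + s)) :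
    ∃ K, 0 ≤ K ∧ ∀ t ≤ t₀, 0 < t → a t ≤ K * t := by
  have hM0 : 0 ≤ M := h0.trans (hM 0 (zero_le))
  have ht₀' : (0 : ℝ) < t₀ := by exact_mod_cast ht₀
  -- Iterating `n = ⌊t₀ / δ⌋` steps of length `δ` gives `n c a(δ) ≤ M + n |C| δ`, and `n δ ≥ t₀ / 2`
  -- turns `M / (n c)` into `2 M δ / (c t₀)`.
  refine ⟨2 * M / (c * t₀) + |C| / c, by positivity, fun δ hδ hδ0 => ?_⟩
  have hδ0' : (0 : ℝ) < δ := by exact_mod_cast hδ0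
  have hδ' : (δ : ℝ) ≤ t₀ := by exact_mod_cast hδ
  have key (n : ℕ) (hn : n * δ ≤ t₀) : n * (c * a δ) - n * (C * δ) ≤ a (n * δ) := by
    induction n with
    | zero => simpa using h0
    | succ n ih =>
      have h1 : ((n + 1 : ℕ) : ℝ≥0) * δ = n * δ + δ := by push_cast; ring
      rw [h1] at hn ⊢
      have h2 := ih (le_trans (by simp) hn)
      have h3 := h _ _ hδ0 hn
      push_cast
      linarith
  set n := ⌊(t₀ : ℝ) / δ⌋₊ with hn
  have hn1 : (n : ℝ) ≤ t₀ / δ := Nat.floor_le (by positivity)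
  have hn2 : (t₀ : ℝ) / δ < n + 1 := Nat.lt_floor_add_one _
  have hn3 : 1 ≤ n := Nat.le_floor (by rw [Nat.cast_one, one_le_div hδ0']; exact hδ')
  have hn3' : (1 : ℝ) ≤ n := by exact_mod_cast hn3
  have hn4 : n * δ ≤ t₀ := by
    have := (le_div_iff₀ hδ0').1 hn1
    exact_mod_cast this
  have hn5 : (t₀ : ℝ) ≤ 2 * n * δ := by
    have := (div_lt_iff₀ hδ0').1 hn2
    nlinarith
  have h6 := (key n hn4).trans (hM _ hn4)
  have h7 : n * (c * a δ) ≤ M + n * (|C| * δ) := by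
    have : n * (C * δ) ≤ n * (|C| * δ) := by gcongr; exact le_abs_self C
    linarith
  have hcn : 0 < n * c := by positivity
  have h8 : a δ ≤ (M + n * (|C| * δ)) / (n * c) := by
    rw [le_div_iff₀ hcn]; linarith
  refine h8.trans ?_
  rw [add_div, add_mul]
  have e1 : n * (|C| * δ) / (n * c) = |C| / c * δ := by field_simp
  rw [e1]
  gcongr
  rw [div_mul_eq_mul_div, div_le_div_iff₀ hcn (by positivity)]
  have := mul_le_mul_of_nonneg_left hn5 (mul_nonneg hM0 hc.le)
  linarith

/-- An almost additive function that is `O(t)` has a derivative at zero. -/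
lemma exists_tendsto_div_of_almost_additive {a : ℝ≥0 → ℝ} {K : ℝ} {t₀ : ℝ≥0} (ht₀ : 0 < t₀)
    (h0 : a 0 = 0) (hK : ∀ t ≤ t₀, |a t| ≤ K * t)
    (h : ∀ ε : ℝ, 0 < ε → ∃ t₁ : ℝ≥0, 0 < t₁ ∧ ∀ t s : ℝ≥0, t + s ≤ t₁ →
      |a (t + s) - a t - a s| ≤ ε * s) :
    ∃ g : ℝ, Tendsto (fun δ : ℝ≥0 => a δ / (δ : ℝ)) (𝓝[>] 0) (𝓝 g) := by
  have hK0 : 0 ≤ K := by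
    have := (abs_nonneg _).trans (hK t₀ le_rfl)
    exact nonneg_of_mul_nonneg_left this (by exact_mod_cast ht₀)
  rw [← cauchy_map_iff_exists_tendsto, Metric.cauchy_iff]
  refine ⟨inferInstance, fun ε hε => ?_⟩
  -- The quotient at small `δ` is compared with the one at a fixed `t`, writing `t = n δ + r` with
  -- `r ≤ δ`. The total error is `ε/8 * t + (2K + ε/8) δ`, and `η` is chosen to make the second term
  -- at most `ε/8 * t`.
  obtain ⟨t₁, ht₁, h1⟩ := h (ε / 8) (by positivity)
  set t := min t₀ t₁ with ht
  have htpos : 0 < t := lt_min ht₀ ht₁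
  have htpos' : (0 : ℝ) < t := by exact_mod_cast htpos
  have key (δ : ℝ≥0) (n : ℕ) (hn : n * δ ≤ t₁) : |a (n * δ) - n * a δ| ≤ ε / 8 * (n * δ) := by
    induction n with
    | zero => simp [h0]
    | succ n ih =>
      have e1 : ((n + 1 : ℕ) : ℝ≥0) * δ = n * δ + δ := by push_cast; ring
      rw [e1] at hn ⊢
      have h2 := ih (le_trans (by simp) hn)
      have h3 := h1 _ _ hn
      rw [abs_le] at h2 h3 ⊢
      push_cast
      constructor <;> linarith
  obtain ⟨η, hη, hη2⟩ : ∃ η : ℝ≥0, 0 < η ∧ (2 * K + ε / 8) * (η / t) ≤ ε / 8 := by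
    refine ⟨(ε / 8 * t / (2 * K + ε / 8)).toNNReal, ?_, ?_⟩
    · rw [Real.toNNReal_pos]; positivity
    · rw [Real.coe_toNNReal _ (by positivity)]
      apply le_of_eq
      field_simp
  have main (δ : ℝ≥0) (h0δ : 0 < δ) (hδη : δ < η) (hδt : δ < t) :
      |a δ / δ - a t / t| ≤ ε / 4 := by
    have hδ0' : (0 : ℝ) < δ := by exact_mod_cast h0δ
    set n := ⌊(t : ℝ) / δ⌋₊ with hn
    have hn1 : (n : ℝ) * δ ≤ t := (le_div_iff₀ hδ0').1 (Nat.floor_le (by positivity))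
    have hn2 : (t : ℝ) < (n + 1) * δ := (div_lt_iff₀ hδ0').1 (Nat.lt_floor_add_one _)
    have hn1' : n * δ ≤ t := by exact_mod_cast hn1
    obtain ⟨r, hr⟩ := exists_add_of_le hn1'
    have hrR : (t : ℝ) = n * δ + r := by
      have := congrArg ((↑) : ℝ≥0 → ℝ) hr
      push_cast at this
      exact this
    have hrδ : (r : ℝ) ≤ δ := by linarith
    have hrt : r ≤ t₀ := by
      have : r ≤ t := by rw [hr]; simp
      exact this.trans (min_le_left _ _)
    have k1 := key δ n (hn1'.trans (min_le_right _ _))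
    have k2 := h1 (n * δ) r (by rw [← hr]; exact min_le_right _ _)
    rw [← hr] at k2
    have k3 := hK r hrt
    have k4 := hK δ (hδt.le.trans (min_le_left _ _))
    have k5 : |n * a δ - t / δ * a δ| ≤ K * δ := by
      rw [← sub_mul, abs_mul]
      have : |n - (t : ℝ) / δ| ≤ 1 := by
        rw [abs_le]
        constructor
        · have := (div_lt_iff₀ hδ0').2 hn2
          linarith
        · have := (le_div_iff₀ hδ0').2 hn1
          linarith
      calc _ ≤ 1 * |a δ| := by gcongr
        _ ≤ _ := by linarith
    have hKr : K * r ≤ K * δ := by gcongr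
    have k6 : |t / δ * a δ - a t| ≤ ε / 8 * t + (2 * K + ε / 8) * δ := by
      have e1 : ε / 8 * (n * δ) ≤ ε / 8 * t := by gcongr
      have e2 : ε / 8 * r ≤ ε / 8 * δ := by gcongr
      rw [abs_le] at k1 k2 k3 k5 ⊢
      constructor <;> linarith
    have k7 : a δ / δ - a t / t = (t / δ * a δ - a t) / t := by field_simp
    rw [k7, abs_div, abs_of_pos htpos', div_le_iff₀ htpos']
    refine k6.trans ?_
    have k8 : (2 * K + ε / 8) * (δ / t) ≤ ε / 8 := le_trans (by gcongr) hη2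
    have k9 : (2 * K + ε / 8) * δ = (2 * K + ε / 8) * (δ / t) * t := by field_simp
    rw [k9]
    have := mul_le_mul_of_nonneg_right k8 htpos'.le
    linarith
  refine ⟨(fun δ : ℝ≥0 => a δ / (δ : ℝ)) '' Set.Ioo 0 (min η t), image_mem_map
    (Ioo_mem_nhdsGT (lt_min hη htpos)), ?_⟩
  rintro _ ⟨x, hx, rfl⟩ _ ⟨y, hy, rfl⟩
  have a1 := main x hx.1 (hx.2.trans_le (min_le_left _ _)) (hx.2.trans_le (min_le_right _ _))
  have a2 := main y hy.1 (hy.2.trans_le (min_le_left _ _)) (hy.2.trans_le (min_le_right _ _))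
  rw [Real.dist_eq]
  rw [abs_le] at a1 a2
  rw [abs_lt]
  constructor <;> linarith

/-- The square is not Lipschitz, so it is not known to lie in `H` after composition. It is replaced
by `1 - cos`, bounded and Lipschitz, at the cost of a cube, which the hypothesis on `Xᶜ` controls.
-/
lemma sq_le_one_sub_cos (u : ℝ) : u ^ 2 ≤ 2 * (1 - Real.cos u) + 2 * |u| ^ 3 := by
  rcases le_total |u| 1 with h | h
  · have h1 := (abs_le.1 (Real.cos_bound h)).2
    have h2 : |u| ^ 4 ≤ |u| ^ 3 := pow_le_pow_of_le_one (abs_nonneg u) h (by norm_num)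
    have h3 : 0 ≤ |u| ^ 4 := by positivity
    linarith
  · have h1 := Real.cos_le_one u
    have h2 : |u| ^ 2 ≤ |u| ^ 3 := pow_le_pow_right₀ h (by norm_num)
    rw [sq_abs] at h2
    nlinarith [sq_nonneg u]

lemma abs_sin_sub_self_le (u : ℝ) : |Real.sin u - u| ≤ 2 * |u| ^ 3 := by
  rcases le_total |u| 1 with h | h
  · have h1 := Real.sin_bound h
    have h2 : |u| ^ 5 ≤ |u| ^ 3 := pow_le_pow_of_le_one (abs_nonneg u) h (by norm_num)
    have h3 : |Real.sin u - u| ≤ |Real.sin u - (u - u ^ 3 / 6)| + |u ^ 3 / 6| := by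
      have := abs_add_le (Real.sin u - (u - u ^ 3 / 6)) (-(u ^ 3 / 6))
      rw [abs_neg] at this
      rwa [show Real.sin u - (u - u ^ 3 / 6) + -(u ^ 3 / 6) = Real.sin u - u by ring] at this
    rw [abs_div, abs_pow, abs_of_pos (by norm_num : (0 : ℝ) < 6)] at h3
    have : 0 ≤ |u| ^ 3 := by positivity
    linarith
  · have h1 := Real.abs_sin_le_one u
    have h2 : |u| ^ 1 ≤ |u| ^ 3 := pow_le_pow_right₀ h (by norm_num)
    have h3 := abs_sub (Real.sin u) u
    linarith

end RealFunctions

lemma abs_apply_le_norm {d : ℕ} (x : EuclideanSpace ℝ (Fin d)) (i : Fin d) : |x i| ≤ ‖x‖ :=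
  PiLp.norm_apply_le x i

lemma apply_eq_sum {d : ℕ} (l : EuclideanSpace ℝ (Fin d) →L[ℝ] ℝ) (x : EuclideanSpace ℝ (Fin d)) :
    l x = ∑ i, x i * l (EuclideanSpace.single i 1) := by
  conv_lhs => rw [← (EuclideanSpace.basisFun (Fin d) ℝ).sum_repr x]
  simp

/-- The conditions on the continuous and the jump part of a `G`-Lévy process. -/
structure IsLevyDecomposition {d : ℕ} (S : SublinearExpectationSpace Ω)
    (Xc Xd : ℝ≥0 → Ω → EuclideanSpace ℝ (Fin d)) : Prop where
  levy : IsLevyProcess S (fun t ω => (Xc t ω, Xd t ω))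
  cube_mem : ∀ᶠ t in 𝓝[>] (0 : ℝ≥0), (fun ω => ‖Xc t ω‖ ^ 3) ∈ S.H
  tendsto : Tendsto (fun t : ℝ≥0 => S.E (fun ω => ‖Xc t ω‖ ^ 3) / (t : ℝ)) (𝓝[>] 0) (𝓝 0)
  jump_le : ∃ C : ℝ, ∀ t : ℝ≥0, S.E (fun ω => ‖Xd t ω‖) ≤ C * t

/-! ### Small-time bounds for the continuous and the jump part. -/

namespace IsLevyDecomposition

variable {d : ℕ} {Xc Xd : ℝ≥0 → Ω → EuclideanSpace ℝ (Fin d)}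

lemma left_zero (h : IsLevyDecomposition S Xc Xd) (ω : Ω) : Xc 0 ω = 0 :=
  congrArg Prod.fst (h.levy.zero ω)

/-- The bound `1 / 64` serves only `exists_E_one_sub_cos_le`, where `16 E[|Xᶜ_t|³]` has to be at
most `1 / 4`. -/
lemma exists_cube_le (h : IsLevyDecomposition S Xc Xd) {ε : ℝ} (hε : 0 < ε) :
    ∃ t₀ : ℝ≥0, 0 < t₀ ∧ t₀ ≤ 1 / 64 ∧ ∀ t ≤ t₀, (fun ω => ‖Xc t ω‖ ^ 3) ∈ S.H ∧
      S.E (fun ω => ‖Xc t ω‖ ^ 3) ≤ ε * t := by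
  have h1 := h.tendsto.eventually (gt_mem_nhds hε)
  obtain ⟨u, hu, hu2⟩ := mem_nhdsGT_iff_exists_Ioo_subset.1 (h.cube_mem.and h1)
  have hu' : 0 < u := hu
  refine ⟨min (u / 2) (1 / 64), lt_min (half_pos hu') (by norm_num), min_le_right _ _,
    fun t ht => ?_⟩
  rcases eq_or_ne t 0 with rfl | ht0
  · simp [h.left_zero, S.const, S.const_mem]
  · have htpos := pos_iff_ne_zero.2 ht0
    have := hu2 ⟨htpos, (ht.trans (min_le_left _ _)).trans_lt (half_lt_self hu')⟩
    refine ⟨this.1, ?_⟩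
    have h3 := this.2.le
    rwa [div_le_iff₀ (by exact_mod_cast htpos)] at h3

lemma left_comp_mem (h : IsLevyDecomposition S Xc Xd) (t : ℝ≥0)
    {φ : EuclideanSpace ℝ (Fin d) → ℝ} (hφ : ∃ K : ℝ≥0, LipschitzWith K φ) :
    (fun ω => φ (Xc t ω)) ∈ S.H := by
  obtain ⟨K, hK⟩ := hφ
  exact h.levy.comp_mem t (φ := fun z => φ z.1) ⟨_, hK.comp LipschitzWith.prod_fst⟩

lemma norm_right_mem (h : IsLevyDecomposition S Xc Xd) (t : ℝ≥0) :
    (fun ω => ‖Xd t ω‖) ∈ S.H :=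
  h.levy.comp_mem t (φ := fun z => ‖z.2‖) ⟨_, lipschitzWith_one_norm.comp LipschitzWith.prod_snd⟩

lemma linear_mem (h : IsLevyDecomposition S Xc Xd) (t : ℝ≥0)
    (l : EuclideanSpace ℝ (Fin d) →L[ℝ] ℝ) : (fun ω => l (Xc t ω)) ∈ S.H :=
  h.left_comp_mem t ⟨_, l.lipschitz⟩

/-- For linear `l` the semigroup identity makes `t ↦ E[l(Xᶜ_t)]` exactly additive, and `r ≤ 1 + r³`
bounds it above on `[0, t₀]`. -/
lemma exists_E_linear_le_aux (h : IsLevyDecomposition S Xc Xd)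
    (l : EuclideanSpace ℝ (Fin d) →L[ℝ] ℝ) {t₀ : ℝ≥0} (ht₀ : 0 < t₀) (ht₁ : t₀ ≤ 1 / 64)
    (hcube : ∀ t ≤ t₀, (fun ω => ‖Xc t ω‖ ^ 3) ∈ S.H ∧ S.E (fun ω => ‖Xc t ω‖ ^ 3) ≤ 1 * t) :
    ∃ K, 0 ≤ K ∧ ∀ t ≤ t₀, S.E (fun ω => l (Xc t ω)) ≤ K * t := by
  have key := exists_le_mul_of_superadditive (a := fun t => S.E (fun ω => l (Xc t ω)))
    (M := ‖l‖ * 2) (c := 1) (C := 0) ht₀ one_pos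
    (by simp [h.left_zero, S.const]) (fun t ht => ?_) (fun t s hs hts => ?_)
  · obtain ⟨K, hK, hK2⟩ := key
    refine ⟨K, hK, fun t ht => ?_⟩
    rcases eq_or_ne t 0 with rfl | h0
    · simp [h.left_zero, S.const]
    · exact hK2 t ht (pos_iff_ne_zero.2 h0)
  · obtain ⟨hm, hm2⟩ := hcube t ht
    have ht' : (t : ℝ) ≤ 1 := by
      have : t ≤ 1 := (ht.trans ht₁).trans (by
        rw [← NNReal.coe_le_coe]; norm_num)
      exact_mod_cast this
    have h1 : (fun ω => 1 + ‖Xc t ω‖ ^ 3) ∈ S.H := S.H.add_mem (S.const_mem 1) hm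
    have h2 : (fun ω => ‖l‖ * (1 + ‖Xc t ω‖ ^ 3)) ∈ S.H := S.H.smul_mem ‖l‖ h1
    refine (S.mono _ h2 _ (h.linear_mem t l) fun ω => ?_).trans ?_
    · refine (le_abs_self _).trans ((l.le_opNorm _).trans ?_)
      gcongr
      set r := ‖Xc t ω‖
      have hr : 0 ≤ r := norm_nonneg _
      nlinarith [mul_nonneg hr (sq_nonneg (r - 1)), sq_nonneg (r - 1)]
    · rw [S.E_const_mul h1 (norm_nonneg _), S.E_const_add hm]
      gcongr
      linarith
  · simp only [one_mul, zero_mul, sub_zero]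
    rw [h.levy.E_comp_add t s (φ := fun z => l z.1) ⟨_, l.lipschitz.comp LipschitzWith.prod_fst⟩]
    simp only [Prod.fst_add, map_add]
    have : (fun ω => S.E (fun ω' => l (Xc t ω) + l (Xc s ω'))) =
        fun ω => S.E (fun ω' => l (Xc s ω')) + l (Xc t ω) := by
      funext ω
      rw [S.E_const_add (h.linear_mem s l), add_comm]
    rw [this, S.E_const_add (h.linear_mem t l), add_comm]

/-- The mean uncertainty of the continuous part is of order `t`. -/
lemma exists_E_linear_le (h : IsLevyDecomposition S Xc Xd) {t₀ : ℝ≥0} (ht₀ : 0 < t₀)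
    (ht₁ : t₀ ≤ 1 / 64)
    (hcube : ∀ t ≤ t₀, (fun ω => ‖Xc t ω‖ ^ 3) ∈ S.H ∧ S.E (fun ω => ‖Xc t ω‖ ^ 3) ≤ 1 * t) :
    ∃ K, 0 ≤ K ∧ ∀ t ≤ t₀, ∀ l : EuclideanSpace ℝ (Fin d) →L[ℝ] ℝ,
      S.E (fun ω => l (Xc t ω)) ≤ K * ‖l‖ * t := by
  -- Both signs of each coordinate are needed because `E` is only positively homogeneous.
  choose A hA hA2 using fun i : Fin d =>
    h.exists_E_linear_le_aux (EuclideanSpace.proj i) ht₀ ht₁ hcube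
  choose B hB hB2 using fun i : Fin d =>
    h.exists_E_linear_le_aux (-EuclideanSpace.proj i) ht₀ ht₁ hcube
  refine ⟨∑ i, (A i + B i), Finset.sum_nonneg fun i _ => add_nonneg (hA i) (hB i),
    fun t ht l => ?_⟩
  have hp (i : Fin d) : (fun ω => Xc t ω i) ∈ S.H := h.linear_mem t (EuclideanSpace.proj i)
  have hp' (i : Fin d) : (fun ω => -Xc t ω i) ∈ S.H := S.H.neg_mem (hp i)
  have hm (i : Fin d) : (fun ω => Xc t ω i * l (EuclideanSpace.single i 1)) ∈ S.H := by
    simp_rw [mul_comm _ (l _)]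
    exact S.H.smul_mem _ (hp i)
  have hs := (S.E_sum_le Finset.univ fun i _ => hm i).2
  rw [funext fun ω => apply_eq_sum l (Xc t ω)]
  refine hs.trans ?_
  rw [Finset.sum_mul, Finset.sum_mul]
  refine Finset.sum_le_sum fun i _ => ?_
  have hn : |l (EuclideanSpace.single i 1)| ≤ ‖l‖ := by
    simpa using l.le_opNorm (EuclideanSpace.single i 1)
  set c := l (EuclideanSpace.single i 1)
  have e1 := hA2 i t ht
  have e2 := hB2 i t ht
  simp only [PiLp.proj_apply, neg_apply] at e1 e2
  have ht0 : (0 : ℝ) ≤ t := t.2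
  have hAi := mul_nonneg (hA i) ht0
  have hBi := mul_nonneg (hB i) ht0
  rcases le_total 0 c with hc | hc
  · simp_rw [mul_comm _ c]
    rw [S.E_const_mul (hp i) hc]
    rw [abs_of_nonneg hc] at hn
    calc c * _ ≤ c * (A i * t) := by gcongr
      _ ≤ ‖l‖ * (A i * t) := by gcongr
      _ ≤ _ := by nlinarith [norm_nonneg l]
  · have : (fun ω => Xc t ω i * c) = fun ω => (-c) * (-Xc t ω i) := by funext ω; ring
    rw [this, S.E_const_mul (hp' i) (neg_nonneg.2 hc)]
    rw [abs_of_nonpos hc] at hn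
    calc -c * _ ≤ -c * (B i * t) := by gcongr; linarith
      _ ≤ ‖l‖ * (B i * t) := by gcongr
      _ ≤ _ := by nlinarith [norm_nonneg l]

lemma lipschitz_one_sub_cos (i : Fin d) :
    ∃ K : ℝ≥0, LipschitzWith K (fun x : EuclideanSpace ℝ (Fin d) => 1 - Real.cos (x i)) :=
  ⟨_, (LipschitzWith.const (1 : ℝ)).sub (Real.lipschitzWith_cos.comp
    (EuclideanSpace.proj (𝕜 := ℝ) i : EuclideanSpace ℝ (Fin d) →L[ℝ] ℝ).lipschitz)⟩

/-- The variance of the continuous part is of order `t`. -/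
lemma exists_E_one_sub_cos_le (h : IsLevyDecomposition S Xc Xd) (i : Fin d) {t₀ : ℝ≥0}
    (ht₀ : 0 < t₀) (ht₁ : t₀ ≤ 1 / 64)
    (hcube : ∀ t ≤ t₀, (fun ω => ‖Xc t ω‖ ^ 3) ∈ S.H ∧ S.E (fun ω => ‖Xc t ω‖ ^ 3) ≤ 1 * t) :
    ∃ K, 0 ≤ K ∧ ∀ t ≤ t₀, S.E (fun ω => 1 - Real.cos (Xc t ω i)) ≤ K * t := by
  obtain ⟨K₁, hK₁, hlin⟩ := h.exists_E_linear_le ht₀ ht₁ hcube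
  set m : ℝ≥0 → ℝ := fun t => S.E (fun ω => 1 - Real.cos (Xc t ω i)) with hm
  have hmem (t : ℝ≥0) : (fun ω => 1 - Real.cos (Xc t ω i)) ∈ S.H :=
    h.left_comp_mem t (lipschitz_one_sub_cos i)
  have hm0 (t : ℝ≥0) : 0 ≤ m t :=
    S.E_nonneg (hmem t) fun ω => by linarith [Real.cos_le_one (Xc t ω i)]
  -- Pointwise, `1 - cos u ≤ 1/4 + 16 |u|³`: the first term suffices for `|u| ≤ 1/2`, and otherwise
  -- the second is at least `2`.
  have hmhalf (t : ℝ≥0) (ht : t ≤ t₀) : m t ≤ 1 / 2 := by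
    obtain ⟨hc, hc2⟩ := hcube t ht
    have ht' : (t : ℝ) ≤ 1 / 64 := by exact_mod_cast (ht.trans ht₁)
    have h2 : (fun ω => 16 * ‖Xc t ω‖ ^ 3) ∈ S.H := S.H.smul_mem (16 : ℝ) hc
    have h3 := S.E_le_add_of_le (hmem t) (S.const_mem (1 / 4)) h2 fun ω => by
      have h4 := abs_apply_le_norm (Xc t ω) i
      have h5 : |Xc t ω i| ^ 3 ≤ ‖Xc t ω‖ ^ 3 := by gcongr
      rcases le_total |Xc t ω i| (1 / 2) with h6 | h6
      · have h7 := Real.one_sub_sq_div_two_le_cos (x := Xc t ω i)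
        have h8 : Xc t ω i ^ 2 ≤ (1 / 2) ^ 2 := by
          rw [← sq_abs]; gcongr
        have : 0 ≤ ‖Xc t ω‖ ^ 3 := by positivity
        linarith
      · have h7 := Real.neg_one_le_cos (Xc t ω i)
        have h8 : (1 / 2 : ℝ) ^ 3 ≤ |Xc t ω i| ^ 3 := by gcongr
        linarith
    rw [S.const, S.E_const_mul hc (by norm_num)] at h3
    simp only [hm]
    linarith
  have step (t s : ℝ≥0) (hts : t + s ≤ t₀) : m t + 1 / 2 * m s - (K₁ + 2) * s ≤ m (t + s) := by
    have hs : s ≤ t₀ := le_trans (by simp) hts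
    have ht : t ≤ t₀ := le_trans (by simp) hts
    obtain ⟨hc, hc2⟩ := hcube s hs
    have hLip : ∃ K : ℝ≥0, LipschitzWith K
        (fun z : EuclideanSpace ℝ (Fin d) × EuclideanSpace ℝ (Fin d) =>
          1 - Real.cos (z.1 i)) := by
      obtain ⟨K, hK⟩ := lipschitz_one_sub_cos i
      exact ⟨_, hK.comp LipschitzWith.prod_fst⟩
    have hnn : 0 ≤ 1 - m s := by linarith [hmhalf s hs]
    -- Taking expectations of `ψ` yields `m s + m t - m s * m t - (K₁ + 2) s`, and `m t ≤ 1/2`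
    -- leaves half of `m s`.
    have h1 := h.levy.le_E_comp_add t s (φ := fun z => 1 - Real.cos (z.1 i))
      (ψ := fun z => (m s - (K₁ + 2) * s) + (1 - m s) * (1 - Real.cos (z.1 i))) hLip (by
        obtain ⟨K, hK⟩ := hLip
        exact ⟨_, (LipschitzWith.const _).add ((lipschitzWith_smul (1 - m s)).comp hK)⟩) ?_
    · have h2 : (fun ω => (1 - m s) * (1 - Real.cos (Xc t ω i))) ∈ S.H :=
        S.H.smul_mem _ (hmem t)
      simp only at h1
      rw [S.E_const_add h2, S.E_const_mul (hmem t) hnn] at h1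
      have h3 : m s * m t ≤ m s * (1 / 2) := mul_le_mul_of_nonneg_left (hmhalf t ht) (hm0 s)
      change m s - (K₁ + 2) * s + (1 - m s) * m t ≤ m (t + s) at h1
      linarith
    · intro z
      set u := z.1 i with hu
      set l : EuclideanSpace ℝ (Fin d) →L[ℝ] ℝ := (-Real.sin u) • EuclideanSpace.proj i with hl
      have hln : ‖l‖ ≤ 1 := by
        refine ContinuousLinearMap.opNorm_le_bound _ zero_le_one fun x => ?_
        simp only [hl, smul_apply, PiLp.proj_apply, smul_eq_mul,
          Real.norm_eq_abs, abs_mul, abs_neg]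
        exact mul_le_mul (Real.abs_sin_le_one u) (abs_apply_le_norm x i) (abs_nonneg _) zero_le_one
      have a0 : (fun ω => 1 - Real.cos (u + Xc s ω i)) ∈ S.H :=
        h.levy.translate_mem s z hLip
      have a1 : (fun ω => (-(1 - Real.cos u)) + (1 - Real.cos (u + Xc s ω i))) ∈ S.H :=
        S.H.add_mem (S.const_mem _) a0
      have a2 : (fun ω => (1 - Real.cos u) * (1 - Real.cos (Xc s ω i))) ∈ S.H :=
        S.H.smul_mem _ (hmem s)
      have a3 := h.linear_mem s l
      have a4 : (fun ω => 2 * ‖Xc s ω‖ ^ 3) ∈ S.H := S.H.smul_mem (2 : ℝ) hc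
      -- With `y` the increment, `1 - cos y = [(1 - cos (u + y)) - (1 - cos u)] + (1 - cos u)(1 -
      -- cos y) - sin u sin y`. Replacing `sin y` by `y` costs `2 |y|³` and leaves the linear
      -- functional `l`.
      have b := S.E_le_add_of_le (hmem s) (S.H.add_mem a1 a2) (S.H.add_mem a3 a4) fun ω => by
        have e1 := Real.cos_add u (Xc s ω i)
        have e2 := abs_sin_sub_self_le (Xc s ω i)
        have e3 : |Xc s ω i| ^ 3 ≤ ‖Xc s ω‖ ^ 3 := by gcongr; exact abs_apply_le_norm _ i
        have e4 : |Real.sin u * (Real.sin (Xc s ω i) - Xc s ω i)| ≤ 2 * ‖Xc s ω‖ ^ 3 := by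
          rw [abs_mul]
          calc _ ≤ 1 * |Real.sin (Xc s ω i) - Xc s ω i| := by
                gcongr; exact Real.abs_sin_le_one u
            _ ≤ _ := by linarith
        have e5 := neg_abs_le (Real.sin u * (Real.sin (Xc s ω i) - Xc s ω i))
        simp only [Pi.add_apply, hl, smul_apply, PiLp.proj_apply,
          smul_eq_mul]
        rw [e1]
        linarith
      have b1 := S.E_add_le a1 a2
      have b2 := S.E_add_le a3 a4
      rw [S.E_const_add a0, S.E_const_mul (hmem s)
        (by linarith [Real.cos_le_one u] : 0 ≤ 1 - Real.cos u)] at b1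
      rw [S.E_const_mul hc (by norm_num)] at b2
      have b3 := hlin s hs l
      have b4 : K₁ * ‖l‖ * s ≤ K₁ * 1 * s := by gcongr
      have b5 : m s ≤ _ := b.trans (add_le_add b1 b2)
      have b6 : S.E (fun ω => 1 - Real.cos ((z + (Xc s ω, Xd s ω)).1 i)) =
        S.E (fun ω => 1 - Real.cos (u + Xc s ω i)) := rfl
      rw [b6]
      change m s ≤ -(1 - Real.cos u) + _ + (1 - Real.cos u) * m s + _ at b5
      linarith
  obtain ⟨K, hK, hK2⟩ := exists_le_mul_of_superadditive (a := m) (M := 1 / 2) (c := 1 / 2)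
    (C := K₁ + 2) ht₀ (by norm_num) (hm0 0) hmhalf (fun t s _ => step t s)
  refine ⟨K, hK, fun t ht => ?_⟩
  rcases eq_or_ne t 0 with rfl | h0
  · simp [h.left_zero, S.const]
  · exact hK2 t ht (pos_iff_ne_zero.2 h0)

/-- Functions with a Taylor expansion of second order in the continuous part, and linear growth in
the jump part, have expectations of order `t`. -/
lemma exists_E_le (h : IsLevyDecomposition S Xc Xd) :
    ∃ K, 0 ≤ K ∧ ∃ t₀ : ℝ≥0, 0 < t₀ ∧ ∀ t ≤ t₀,
      ∀ (φ : EuclideanSpace ℝ (Fin d) × EuclideanSpace ℝ (Fin d) → ℝ)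
        (l : EuclideanSpace ℝ (Fin d) →L[ℝ] ℝ) (b c : ℝ), (∃ K : ℝ≥0, LipschitzWith K φ) →
        0 ≤ b → 0 ≤ c → (∀ x y, φ (x, y) ≤ l x + b * ‖x‖ ^ 2 + c * ‖y‖) →
        S.E (fun ω => φ (Xc t ω, Xd t ω)) ≤ K * (‖l‖ + b + c) * t := by
  obtain ⟨t₀, ht₀, ht₁, hcube⟩ := h.exists_cube_le one_pos
  obtain ⟨K₁, hK₁, hlin⟩ := h.exists_E_linear_le ht₀ ht₁ hcube
  choose A hA hA2 using fun i => h.exists_E_one_sub_cos_le i ht₀ ht₁ hcube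
  obtain ⟨C, hC⟩ := h.jump_le
  have hSA : 0 ≤ ∑ i, A i := Finset.sum_nonneg fun i _ => hA i
  refine ⟨K₁ + (∑ i, A i * 2 + 2 * d) + |C|, by rw [← Finset.sum_mul]; positivity, t₀, ht₀,
    fun t ht φ l b c hφ hb hc hle => ?_⟩
  obtain ⟨hm, hm2⟩ := hcube t ht
  have ht0 : (0 : ℝ) ≤ t := t.2
  have hcos (i : Fin d) : (fun ω => 2 * (1 - Real.cos (Xc t ω i))) ∈ S.H :=
    S.H.smul_mem (2 : ℝ) (h.left_comp_mem t (lipschitz_one_sub_cos i))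
  obtain ⟨a1, a2⟩ := S.E_sum_le Finset.univ fun i _ => hcos i
  have a3 : (fun ω => 2 * d * ‖Xc t ω‖ ^ 3) ∈ S.H := S.H.smul_mem (2 * d : ℝ) hm
  have a4 : (fun ω => ∑ i, 2 * (1 - Real.cos (Xc t ω i)) + 2 * d * ‖Xc t ω‖ ^ 3) ∈ S.H :=
    S.H.add_mem a1 a3
  have a5 : (fun ω => b * (∑ i, 2 * (1 - Real.cos (Xc t ω i)) + 2 * d * ‖Xc t ω‖ ^ 3)) ∈ S.H :=
    S.H.smul_mem b a4
  have a6 : (fun ω => c * ‖Xd t ω‖) ∈ S.H := S.H.smul_mem c (h.norm_right_mem t)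
  have a7 := h.linear_mem t l
  have hq : S.E (fun ω => ∑ i, 2 * (1 - Real.cos (Xc t ω i)) + 2 * d * ‖Xc t ω‖ ^ 3) ≤
      (∑ i, A i * 2 + 2 * d) * t := by
    refine (S.E_add_le a1 a3).trans ?_
    rw [S.E_const_mul hm (by positivity), add_mul]
    refine add_le_add (a2.trans ?_) ?_
    · rw [Finset.sum_mul]
      refine Finset.sum_le_sum fun i _ => ?_
      rw [S.E_const_mul (h.left_comp_mem t (lipschitz_one_sub_cos i)) (by norm_num)]
      linarith [hA2 i t ht]
    · rw [one_mul] at hm2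
      gcongr
  have main := S.E_le_add_of_le (h.levy.comp_mem t hφ) (S.H.add_mem a7 a5) a6 fun ω => by
    refine (hle (Xc t ω) (Xd t ω)).trans ?_
    simp only [Pi.add_apply]
    gcongr
    rw [EuclideanSpace.norm_sq_eq]
    calc ∑ i, ‖Xc t ω i‖ ^ 2
        ≤ ∑ i, (2 * (1 - Real.cos (Xc t ω i)) + 2 * ‖Xc t ω‖ ^ 3) := by
          refine Finset.sum_le_sum fun i _ => ?_
          rw [Real.norm_eq_abs, sq_abs]
          refine (sq_le_one_sub_cos _).trans ?_
          gcongr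
          exact abs_apply_le_norm _ i
      _ = _ := by rw [Finset.sum_add_distrib]; simp; ring
  have m1 := S.E_add_le a7 a5
  rw [S.E_const_mul a4 hb] at m1
  rw [S.E_const_mul (h.norm_right_mem t) hc] at main
  have m2 := hlin t ht l
  have m3 := mul_le_mul_of_nonneg_left hq hb
  have m4 : c * S.E (fun ω => ‖Xd t ω‖) ≤ c * (|C| * t) := by
    gcongr
    exact (hC t).trans (by gcongr; exact le_abs_self C)
  refine (main.trans (add_le_add (m1.trans (add_le_add m2 m3)) m4)).trans ?_
  have hln := norm_nonneg l
  have hq0 : 0 ≤ ∑ i, A i * 2 + 2 * (d : ℝ) := by rw [← Finset.sum_mul]; positivity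
  set q := ∑ i, A i * 2 + 2 * (d : ℝ)
  have hC0 := abs_nonneg C
  have e : (K₁ + q + |C|) * (‖l‖ + b + c) * t = K₁ * ‖l‖ * t + b * (q * t) + c * (|C| * t) +
    (K₁ * b + K₁ * c + q * ‖l‖ + q * c + |C| * ‖l‖ + |C| * b) * t := by ring
  rw [e]
  exact le_add_of_nonneg_right (by positivity)

/-- The expectation of a function that is small in the continuous part is governed by jumps. -/
lemma exists_E_le_of_cube (h : IsLevyDecomposition S Xc Xd) :
    ∃ K, 0 ≤ K ∧ ∀ c : ℝ, 0 ≤ c → ∃ t₀ : ℝ≥0, 0 < t₀ ∧ ∀ t ≤ t₀,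
      ∀ φ : EuclideanSpace ℝ (Fin d) × EuclideanSpace ℝ (Fin d) → ℝ,
        (∃ K : ℝ≥0, LipschitzWith K φ) → (∀ x y, φ (x, y) ≤ c * ‖x‖ ^ 3 + ‖y‖) →
        S.E (fun ω => φ (Xc t ω, Xd t ω)) ≤ K * t := by
  obtain ⟨C, hC⟩ := h.jump_le
  refine ⟨|C| + 1, by positivity, fun c hc => ?_⟩
  -- The cubic term then contributes at most `t` whatever `c` is: only `t₀` depends on `c`, not the
  -- final constant.
  obtain ⟨t₀, ht₀, -, hcube⟩ := h.exists_cube_le (ε := 1 / (c + 1)) (by positivity)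
  refine ⟨t₀, ht₀, fun t ht φ hφ hle => ?_⟩
  obtain ⟨hm, hm2⟩ := hcube t ht
  have a1 : (fun ω => c * ‖Xc t ω‖ ^ 3) ∈ S.H := S.H.smul_mem c hm
  have main := S.E_le_add_of_le (h.levy.comp_mem t hφ) a1 (h.norm_right_mem t) fun ω => hle _ _
  rw [S.E_const_mul hm hc] at main
  have h1 : c * S.E (fun ω => ‖Xc t ω‖ ^ 3) ≤ c * (1 / (c + 1) * t) := by gcongr
  have h2 : c * (1 / (c + 1) * t) ≤ 1 * t := by
    rw [← mul_assoc]
    gcongr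
    rw [mul_one_div, div_le_one (by positivity)]
    linarith
  have h3 : C * t ≤ |C| * t := by gcongr; exact le_abs_self C
  linarith [hC t]

/-- The process is continuous in mean at time zero. -/
lemma exists_E_norm_le (h : IsLevyDecomposition S Xc Xd) {ε : ℝ} (hε : 0 < ε) :
    ∃ t₀ : ℝ≥0, 0 < t₀ ∧ ∀ t ≤ t₀, S.E (fun ω => ‖Xc t ω + Xd t ω‖) ≤ ε := by
  obtain ⟨K, hK, hc⟩ := h.exists_E_le_of_cube
  -- This constant gives `|x| ≤ ε/2 + (4/ε²) |x|³` for all `x`.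
  obtain ⟨t₀, ht₀, h0⟩ := hc (4 / ε ^ 2) (by positivity)
  have hpos : 0 < ε / 2 / (K + 1) := by positivity
  refine ⟨min t₀ (ε / 2 / (K + 1)).toNNReal, lt_min ht₀ (Real.toNNReal_pos.2 hpos),
    fun t ht => ?_⟩
  have hL : LipschitzWith 2
      (fun z : EuclideanSpace ℝ (Fin d) × EuclideanSpace ℝ (Fin d) => ‖z.1 + z.2‖) := by
    have := lipschitzWith_one_norm.comp ((LipschitzWith.prod_fst (α := EuclideanSpace ℝ (Fin d))
      (β := EuclideanSpace ℝ (Fin d))).add LipschitzWith.prod_snd)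
    rwa [one_mul, one_add_one_eq_two] at this
  have hmem := h.levy.comp_mem t ⟨2, hL⟩
  have h1 := h0 t (ht.trans (min_le_left _ _)) (fun z => -(ε / 2) + ‖z.1 + z.2‖)
    ⟨_, (LipschitzWith.const _).add hL⟩ fun x y => by
      have := norm_add_le x y
      have hx := norm_nonneg x
      have : ‖x‖ ≤ ε / 2 + 4 / ε ^ 2 * ‖x‖ ^ 3 := by
        rcases le_total ‖x‖ (ε / 2) with h1 | h1
        · have : 0 ≤ 4 / ε ^ 2 * ‖x‖ ^ 3 := by positivity
          linarith
        · have : (ε / 2) ^ 2 ≤ ‖x‖ ^ 2 := by gcongr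
          have : 1 ≤ 4 / ε ^ 2 * ‖x‖ ^ 2 := by
            rw [div_mul_eq_mul_div, le_div_iff₀ (by positivity)]
            linarith
          have := mul_le_mul_of_nonneg_right this hx
          have e : 4 / ε ^ 2 * ‖x‖ ^ 2 * ‖x‖ = 4 / ε ^ 2 * ‖x‖ ^ 3 := by ring
          linarith
      simp only
      linarith
  simp only at h1 hmem
  rw [S.E_const_add hmem] at h1
  have ht2 : (t : ℝ) ≤ ε / 2 / (K + 1) := by
    have : t ≤ (ε / 2 / (K + 1)).toNNReal := ht.trans (min_le_right _ _)
    rwa [← Real.le_toNNReal_iff_coe_le hpos.le]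
  have h2 : K * t ≤ (K + 1) * (ε / 2 / (K + 1)) := by
    apply mul_le_mul _ ht2 t.2 (by positivity)
    linarith
  rw [mul_div_cancel₀ _ (by positivity)] at h2
  linarith

end IsLevyDecomposition

/-! ### Taylor estimates and quantitative bounds for `C_b³`. -/

section Calculus

variable {V W : Type*} [NormedAddCommGroup V] [NormedSpace ℝ V]
  [NormedAddCommGroup W] [NormedSpace ℝ W]

lemma norm_sub_zero_le_of_norm_fderiv_le_pow {h : V → W} (hd : Differentiable ℝ h) {L : ℝ}
    (hL : 0 ≤ L) {k : ℕ} {z : V} (hb : ∀ y, ‖y‖ ≤ ‖z‖ → ‖fderiv ℝ h y‖ ≤ L * ‖y‖ ^ k) :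
    ‖h z - h 0‖ ≤ L * ‖z‖ ^ (k + 1) := by
  have := (convex_closedBall (0 : V) ‖z‖).norm_image_sub_le_of_norm_fderiv_le (f := h)
    (𝕜 := ℝ) (C := L * ‖z‖ ^ k) (x := 0) (y := z) (fun x _ => hd x)
    (fun x hx => by
      have hx' : ‖x‖ ≤ ‖z‖ := by simpa using hx
      exact (hb x hx').trans (by gcongr)) (by simp) (by simp)
  rwa [sub_zero, mul_assoc, ← pow_succ] at this

/-- The mean value inequality on the ball of radius `‖z‖`, applied after subtracting the linear
part. Factorials are given up so that a bound of any order `k` passes to order `k + 1`. -/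
lemma norm_taylor_one_le {h : V → W} (hd : Differentiable ℝ h) {L : ℝ} (hL : 0 ≤ L) {k : ℕ} {z : V}
    (hb : ∀ y, ‖y‖ ≤ ‖z‖ → ‖fderiv ℝ h y - fderiv ℝ h 0‖ ≤ L * ‖y‖ ^ k) :
    ‖h z - h 0 - fderiv ℝ h 0 z‖ ≤ L * ‖z‖ ^ (k + 1) := by
  have hd' : Differentiable ℝ fun y => h y - fderiv ℝ h 0 y :=
    hd.sub (fderiv ℝ h 0).differentiable
  have := norm_sub_zero_le_of_norm_fderiv_le_pow hd' hL (k := k) (z := z) fun y hy => by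
    rw [fderiv_fun_sub (hd y) (fderiv ℝ h 0).differentiableAt, ContinuousLinearMap.fderiv]
    exact hb y hy
  simpa [sub_right_comm] using this

end Calculus

section Cb

variable {d : ℕ}

/-- Quantitative consequences of membership in `C_b³`. -/
structure HasCbBound (f : EuclideanSpace ℝ (Fin d) → ℝ) (L : ℝ) : Prop where
  nonneg : 0 ≤ L
  diff : Differentiable ℝ f
  diff_fderiv : Differentiable ℝ (fderiv ℝ f)
  isSymm : IsSymmSndFDerivAt ℝ f 0
  abs_le : ∀ x, |f x| ≤ L
  norm_fderiv_le : ∀ x, ‖fderiv ℝ f x‖ ≤ L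
  fderiv_lip : ∀ x y, ‖fderiv ℝ f x - fderiv ℝ f y‖ ≤ L * ‖x - y‖
  snd_lip : ∀ x y, ‖fderiv ℝ (fderiv ℝ f) x - fderiv ℝ (fderiv ℝ f) y‖ ≤ L * ‖x - y‖

set_option maxSynthPendingDepth 3 in
lemma IsCb.exists_bound {f : EuclideanSpace ℝ (Fin d) → ℝ} (hf : IsCb 3 f) :
    ∃ L, HasCbBound f L := by
  obtain ⟨hc, hb⟩ := hf
  obtain ⟨C0, h0⟩ := hb 0 (by norm_num)
  obtain ⟨C1, h1⟩ := hb 1 (by norm_num)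
  obtain ⟨C2, h2⟩ := hb 2 (by norm_num)
  obtain ⟨C3, h3⟩ := hb 3 le_rfl
  have c1 : ContDiff ℝ 2 (fderiv ℝ f) := hc.fderiv_right (by norm_num)
  have c2 : ContDiff ℝ 1 (fderiv ℝ (fderiv ℝ f)) := c1.fderiv_right (by norm_num)
  have d0 : Differentiable ℝ f := hc.differentiable (by norm_num)
  have d1 : Differentiable ℝ (fderiv ℝ f) := c1.differentiable (by norm_num)
  have d2 : Differentiable ℝ (fderiv ℝ (fderiv ℝ f)) := c2.differentiable (by norm_num)
  have b0 (x : EuclideanSpace ℝ (Fin d)) : |f x| ≤ C0 := by simpa using h0 x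
  have b1 (x : EuclideanSpace ℝ (Fin d)) : ‖fderiv ℝ f x‖ ≤ C1 := by
    have := h1 x
    rwa [← norm_iteratedFDeriv_fderiv, norm_iteratedFDeriv_zero] at this
  have b2 (x : EuclideanSpace ℝ (Fin d)) : ‖fderiv ℝ (fderiv ℝ f) x‖ ≤ C2 := by
    have := h2 x
    rwa [← norm_iteratedFDeriv_fderiv, ← norm_iteratedFDeriv_fderiv,
      norm_iteratedFDeriv_zero] at this
  have b3 (x : EuclideanSpace ℝ (Fin d)) : ‖fderiv ℝ (fderiv ℝ (fderiv ℝ f)) x‖ ≤ C3 := by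
    have := h3 x
    rwa [← norm_iteratedFDeriv_fderiv, ← norm_iteratedFDeriv_fderiv,
      ← norm_iteratedFDeriv_fderiv, norm_iteratedFDeriv_zero] at this
  have p0 := (abs_nonneg _).trans (b0 0)
  have p1 := (norm_nonneg _).trans (b1 0)
  have p2 := (norm_nonneg _).trans (b2 0)
  have p3 := (norm_nonneg _).trans (b3 0)
  refine ⟨C0 + C1 + C2 + C3, by positivity, d0, d1,
    hc.contDiffAt.isSymmSndFDerivAt (by simp; norm_num), fun x => by linarith [b0 x],
    fun x => by linarith [b1 x], fun x y => ?_, fun x y => ?_⟩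
  · refine (convex_univ.norm_image_sub_le_of_norm_fderiv_le (𝕜 := ℝ) (fun x _ => d1 x)
      (fun x _ => b2 x) (Set.mem_univ y) (Set.mem_univ x)).trans ?_
    gcongr
    linarith
  · refine (convex_univ.norm_image_sub_le_of_norm_fderiv_le (𝕜 := ℝ) (fun x _ => d2 x)
      (fun x _ => b3 x) (Set.mem_univ y) (Set.mem_univ x)).trans ?_
    gcongr
    linarith

lemma exists_lipschitz_of_fderiv_le {f : EuclideanSpace ℝ (Fin d) → ℝ} (hd : Differentiable ℝ f)
    {L : ℝ} (hL : ∀ x, ‖fderiv ℝ f x‖ ≤ L) : ∃ K : ℝ≥0, LipschitzWith K f := by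
  refine ⟨L.toNNReal, lipschitzWith_of_nnnorm_fderiv_le hd fun x => ?_⟩
  rw [← NNReal.coe_le_coe, coe_nnnorm]
  exact (hL x).trans (Real.le_coe_toNNReal L)

lemma exists_lipschitz_comp_add {f : EuclideanSpace ℝ (Fin d) → ℝ}
    (hf : ∃ K : ℝ≥0, LipschitzWith K f) :
    ∃ K : ℝ≥0, LipschitzWith K (fun z : EuclideanSpace ℝ (Fin d) × EuclideanSpace ℝ (Fin d) => f (z.1 + z.2)) := by
  obtain ⟨K, hK⟩ := hf
  exact ⟨_, hK.comp (LipschitzWith.prod_fst.add LipschitzWith.prod_snd)⟩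

end Cb

/-! ### Existence of the limit `G_X`. -/

namespace IsLevyDecomposition

variable {d : ℕ} {Xc Xd : ℝ≥0 → Ω → EuclideanSpace ℝ (Fin d)}

lemma sum_comp_mem (h : IsLevyDecomposition S Xc Xd) (t : ℝ≥0)
    {f : EuclideanSpace ℝ (Fin d) → ℝ} (hf : ∃ K : ℝ≥0, LipschitzWith K f) :
    (fun ω => f (Xc t ω + Xd t ω)) ∈ S.H :=
  h.levy.comp_mem t (exists_lipschitz_comp_add hf)

/-- The increment of `g` is expanded to first order in the continuous part with a quadratic
remainder, and estimated by the Lipschitz bound in the jump part. Linearity in `B` is what the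
almost-additivity of `exists_tendsto` needs. -/
lemma exists_E_le_of_fderiv (h : IsLevyDecomposition S Xc Xd) :
    ∃ K, 0 ≤ K ∧ ∃ t₀ : ℝ≥0, 0 < t₀ ∧ ∀ t ≤ t₀,
      ∀ (g : EuclideanSpace ℝ (Fin d) → ℝ) (B : ℝ), Differentiable ℝ g → 0 ≤ B → g 0 = 0 →
        (∀ x, ‖fderiv ℝ g x‖ ≤ B) → (∀ x, ‖fderiv ℝ g x - fderiv ℝ g 0‖ ≤ B * ‖x‖) →
        S.E (fun ω => g (Xc t ω + Xd t ω)) ≤ K * B * t := by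
  obtain ⟨K, hK, t₀, ht₀, hle⟩ := h.exists_E_le
  refine ⟨K * 3, by positivity, t₀, ht₀, fun t ht g B hg hB g0 h1 h2 => ?_⟩
  refine (hle t ht (fun z => g (z.1 + z.2)) (fderiv ℝ g 0) B B
    (exists_lipschitz_comp_add (exists_lipschitz_of_fderiv_le hg h1)) hB hB
    fun x y => ?_).trans ?_
  · have e1 := norm_taylor_one_le hg hB (k := 1) (z := x) fun y _ => by
      rw [pow_one]; exact h2 y
    have e2 := convex_univ.norm_image_sub_le_of_norm_fderiv_le (𝕜 := ℝ) (fun x _ => hg x)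
      (fun x _ => h1 x) (Set.mem_univ x) (Set.mem_univ (x + y))
    rw [Real.norm_eq_abs] at e1 e2
    rw [add_sub_cancel_left] at e2
    rw [g0, sub_zero, one_add_one_eq_two] at e1
    simp only
    linarith [(abs_le.1 e1).2, (abs_le.1 e2).2]
  · have : ‖fderiv ℝ g 0‖ + B + B ≤ 3 * B := by linarith [h1 0]
    calc K * (‖fderiv ℝ g 0‖ + B + B) * t ≤ K * (3 * B) * t := by
          gcongr
      _ = _ := by ring

/-- The functional `G_X` exists on `C_b³`. -/
lemma exists_tendsto (h : IsLevyDecomposition S Xc Xd) {f : EuclideanSpace ℝ (Fin d) → ℝ}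
    {L : ℝ} (hf : HasCbBound f L) (hf0 : f 0 = 0) :
    ∃ g : ℝ, Tendsto (fun δ : ℝ≥0 => S.E (fun ω => f (Xc δ ω + Xd δ ω)) / (δ : ℝ))
      (𝓝[>] 0) (𝓝 g) := by
  obtain ⟨K, hK, t₀, ht₀, hle⟩ := h.exists_E_le_of_fderiv
  have hL := hf.nonneg
  have hlip := exists_lipschitz_of_fderiv_le hf.diff hf.norm_fderiv_le
  have hmem (t : ℝ≥0) := h.sum_comp_mem t hlip
  have hnorm : ∃ K : ℝ≥0, LipschitzWith K fun x : EuclideanSpace ℝ (Fin d) => ‖x‖ :=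
    ⟨1, lipschitzWith_one_norm⟩
  set a : ℝ≥0 → ℝ := fun t => S.E (fun ω => f (Xc t ω + Xd t ω)) with ha
  have incr (x : EuclideanSpace ℝ (Fin d)) (s : ℝ≥0) (hs : s ≤ t₀) :
      S.E (fun ω => f (x + (Xc s ω + Xd s ω))) ≤ f x + a s + K * L * s * ‖x‖ ∧
      f x + a s - K * L * s * ‖x‖ ≤ S.E (fun ω => f (x + (Xc s ω + Xd s ω))) := by
    -- This mixed difference vanishes at `0`, and its first two derivatives are bounded by `L ‖x‖`;
    -- hence its expectation at time `s` is at most `K L ‖x‖ s`.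
    set g : EuclideanSpace ℝ (Fin d) → ℝ := fun z => f (x + z) - f x - f z with hg
    have hfx : Differentiable ℝ fun z => f (x + z) :=
      hf.diff.comp (differentiable_id.const_add x)
    have hgd : Differentiable ℝ g := (hfx.sub_const _).sub hf.diff
    have hgf (z : EuclideanSpace ℝ (Fin d)) :
        fderiv ℝ g z = fderiv ℝ f (x + z) - fderiv ℝ f z := by
      rw [hg, fderiv_fun_sub ((hfx z).sub_const _) (hf.diff z), fderiv_sub_const,
        fderiv_comp_add_left]
    have g0 : g 0 = 0 := by simp [hg, hf0]
    have hg1 (z : EuclideanSpace ℝ (Fin d)) : ‖fderiv ℝ g z‖ ≤ L * ‖x‖ := by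
      rw [hgf]
      simpa using hf.fderiv_lip (x + z) z
    have hg2 (z : EuclideanSpace ℝ (Fin d)) :
        ‖fderiv ℝ g z - fderiv ℝ g 0‖ ≤ L * ‖x‖ * ‖z‖ := by
      have hd1 : Differentiable ℝ fun z => fderiv ℝ f (x + z) :=
        hf.diff_fderiv.comp (differentiable_id.const_add x)
      have hd2 : Differentiable ℝ (fderiv ℝ g) := by
        rw [funext hgf]; exact hd1.sub hf.diff_fderiv
      have := convex_univ.norm_image_sub_le_of_norm_fderiv_le (𝕜 := ℝ) (f := fderiv ℝ g)
        (C := L * ‖x‖) (fun z _ => hd2 z) (fun z _ => by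
          rw [funext hgf, fderiv_fun_sub (hd1 z) (hf.diff_fderiv z), fderiv_comp_add_left]
          simpa using hf.snd_lip (x + z) z) (Set.mem_univ 0) (Set.mem_univ z)
      simpa using this
    have hLx : 0 ≤ L * ‖x‖ := by positivity
    have b1 := hle s hs g _ hgd hLx g0 hg1 hg2
    have b2 := hle s hs (fun z => -g z) _ hgd.neg hLx (by simp [g0])
      (fun z => by rw [fderiv_fun_neg, norm_neg]; exact hg1 z)
      (fun z => by
        rw [fderiv_fun_neg, fderiv_fun_neg, neg_sub_neg, norm_sub_rev]; exact hg2 z)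
    have hgl := exists_lipschitz_of_fderiv_le hgd hg1
    have m1 := h.sum_comp_mem s hgl
    have m2 : (fun ω => -g (Xc s ω + Xd s ω)) ∈ S.H := S.H.neg_mem m1
    have m3 : (fun ω => f x + f (Xc s ω + Xd s ω)) ∈ S.H := S.H.add_mem (S.const_mem _) (hmem s)
    have m4 : (fun ω => f (x + (Xc s ω + Xd s ω))) ∈ S.H := by
      convert S.H.add_mem m1 m3 using 1
      funext ω
      simp only [hg, Pi.add_apply]
      ring
    constructor
    · have := S.E_le_add_of_le m4 m3 m1 fun ω => by simp only [hg]; linarith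
      rw [S.E_const_add (hmem s)] at this
      change _ ≤ f x + a s + _ at this
      linarith
    · have := S.E_le_add_of_le m3 m4 m2 fun ω => by simp only [hg]; linarith
      rw [S.E_const_add (hmem s)] at this
      change f x + a s ≤ _ at this
      linarith
  refine exists_tendsto_div_of_almost_additive (a := a) (K := K * L) ht₀ ?_ (fun t ht => ?_)
    fun ε hε => ?_
  · have h1 : ∀ ω, Xc 0 ω = 0 := h.left_zero
    have h2 : ∀ ω, Xd 0 ω = 0 := fun ω => congrArg Prod.snd (h.levy.zero ω)
    simp [ha, h1, h2, hf0, S.const]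
  · have b1 := hle t ht f L hf.diff hL hf0 hf.norm_fderiv_le
      (fun x => by simpa using hf.fderiv_lip x 0)
    have b2 := hle t ht (fun z => -f z) L hf.diff.neg hL (by simp [hf0])
      (fun z => by rw [fderiv_fun_neg, norm_neg]; exact hf.norm_fderiv_le z)
      (fun z => by
        rw [fderiv_fun_neg, fderiv_fun_neg, neg_sub_neg, norm_sub_rev]
        simpa using hf.fderiv_lip z 0)
    have b3 := S.neg_E_neg_le (hmem t)
    rw [abs_le]
    exact ⟨by simp only [ha]; linarith, b1⟩
  -- Averaging `incr` over `x = X_t` gives the error `K L s E[‖X_t‖]`, which continuity in mean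
  -- makes at most `ε s`.
  · obtain ⟨t₁, ht₁, hn⟩ := h.exists_E_norm_le (ε := ε / (K * L + 1)) (by positivity)
    refine ⟨min t₀ t₁, lt_min ht₀ ht₁, fun t s hts => ?_⟩
    have hs : s ≤ t₀ := le_trans (by simp) (hts.trans (min_le_left _ _))
    have ht : t ≤ t₁ := le_trans (by simp) (hts.trans (min_le_right _ _))
    set c := K * L * s with hc
    have hc0 : 0 ≤ c := by positivity
    have nmem := h.sum_comp_mem t hnorm
    have cmem : (fun ω => c * ‖Xc t ω + Xd t ω‖) ∈ S.H := S.H.smul_mem c nmem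
    have hcE : c * S.E (fun ω => ‖Xc t ω + Xd t ω‖) ≤ ε * s := by
      have h1 : c * S.E (fun ω => ‖Xc t ω + Xd t ω‖) ≤ c * (ε / (K * L + 1)) := by
        gcongr; exact hn t ht
      refine h1.trans ?_
      have e : c * (ε / (K * L + 1)) = (K * L / (K * L + 1)) * (ε * s) := by
        rw [hc]; field_simp
      rw [e]
      have : K * L / (K * L + 1) ≤ 1 := by
        rw [div_le_one (by positivity)]; linarith
      exact mul_le_of_le_one_left (by positivity) this
    have hfl := exists_lipschitz_comp_add hlip
    have hnl := exists_lipschitz_comp_add hnorm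
    have up := h.levy.E_comp_add_le t s (φ := fun z => f (z.1 + z.2))
      (ψ := fun z => a s + (f (z.1 + z.2) + c * ‖z.1 + z.2‖)) hfl (by
        obtain ⟨K1, h1⟩ := hfl
        obtain ⟨K2, h2⟩ := hnl
        exact ⟨_, (LipschitzWith.const _).add (h1.add ((lipschitzWith_smul c).comp h2))⟩)
      fun z => by
        have := (incr (z.1 + z.2) s hs).1
        simp only [Prod.fst_add, Prod.snd_add, fun ω => add_add_add_comm z.1 (Xc s ω) z.2 (Xd s ω)]
        linarith
    have lo := h.levy.le_E_comp_add t s (φ := fun z => f (z.1 + z.2))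
      (ψ := fun z => a s + (f (z.1 + z.2) - c * ‖z.1 + z.2‖)) hfl (by
        obtain ⟨K1, h1⟩ := hfl
        obtain ⟨K2, h2⟩ := hnl
        exact ⟨_, (LipschitzWith.const _).add (h1.sub ((lipschitzWith_smul c).comp h2))⟩)
      fun z => by
        have := (incr (z.1 + z.2) s hs).2
        simp only [Prod.fst_add, Prod.snd_add, fun ω => add_add_add_comm z.1 (Xc s ω) z.2 (Xd s ω)]
        linarith
    have mp : (fun ω => f (Xc t ω + Xd t ω) + c * ‖Xc t ω + Xd t ω‖) ∈ S.H :=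
      S.H.add_mem (hmem t) cmem
    have mm : (fun ω => f (Xc t ω + Xd t ω) - c * ‖Xc t ω + Xd t ω‖) ∈ S.H :=
      S.H.sub_mem (hmem t) cmem
    simp only at up lo
    rw [S.E_const_add mp] at up
    rw [S.E_const_add mm] at lo
    have k1 := S.E_add_le (hmem t) cmem
    have k2 := S.E_sub_E_le (hmem t) cmem
    rw [S.E_const_mul nmem hc0] at k1 k2
    change a (t + s) ≤ _ at up
    change _ ≤ a (t + s) at lo
    change _ ≤ a t + _ at k1
    change a t - _ ≤ _ at k2
    rw [abs_le]
    constructor <;> linarith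

end IsLevyDecomposition

/-! ### Upper rates and the Hahn-Banach theorem. -/

section Rate

variable {V : Type*} [NormedAddCommGroup V]

/-- `f` is dominated by a Lipschitz function `g` with `E[g(X_δ)] ≤ K δ` for small `δ`. -/
def HasRate (S : SublinearExpectationSpace Ω) (X : ℝ≥0 → Ω → V) (f : V → ℝ) (K : ℝ) : Prop :=
  ∃ g : V → ℝ, (∃ L : ℝ≥0, LipschitzWith L g) ∧ (∀ z, f z ≤ g z) ∧
    ∀ᶠ δ in 𝓝[>] (0 : ℝ≥0), S.E (fun ω => g (X δ ω)) ≤ K * δ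

variable {X : ℝ≥0 → Ω → V}

lemma HasRate.mono {f g : V → ℝ} {K : ℝ} (hg : HasRate S X g K) (h : ∀ z, f z ≤ g z) :
    HasRate S X f K := by
  obtain ⟨u, hu, hle, hE⟩ := hg
  exact ⟨u, hu, fun z => (h z).trans (hle z), hE⟩

lemma HasRate.zero : HasRate S X 0 0 :=
  ⟨0, ⟨0, LipschitzWith.const 0⟩, fun _ => le_rfl, Eventually.of_forall fun δ => by
    rw [zero_mul]; exact (S.const 0).le⟩

variable [NormedSpace ℝ V] [FiniteDimensional ℝ V]

lemma HasRate.add (hX : ∀ t, IsRandomVector S (X t)) {f g : V → ℝ} {K K' : ℝ}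
    (hf : HasRate S X f K) (hg : HasRate S X g K') : HasRate S X (f + g) (K + K') := by
  obtain ⟨u, ⟨L, hu⟩, hle, hE⟩ := hf
  obtain ⟨u', ⟨L', hu'⟩, hle', hE'⟩ := hg
  refine ⟨fun z => u z + u' z, ⟨_, hu.add hu'⟩, fun z => add_le_add (hle z) (hle' z), ?_⟩
  filter_upwards [hE, hE'] with δ h1 h2
  have := S.E_add_le ((hX δ).lipschitz_comp ⟨L, hu⟩) ((hX δ).lipschitz_comp ⟨L', hu'⟩)
  linarith

lemma HasRate.smul (hX : ∀ t, IsRandomVector S (X t)) {f : V → ℝ} {K c : ℝ} (hc : 0 ≤ c)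
    (hf : HasRate S X f K) : HasRate S X (c • f) (c * K) := by
  obtain ⟨u, ⟨L, hu⟩, hle, hE⟩ := hf
  refine ⟨fun z => c * u z, ⟨_, (lipschitzWith_smul c).comp hu⟩,
    fun z => mul_le_mul_of_nonneg_left (hle z) hc, ?_⟩
  filter_upwards [hE] with δ h1
  rw [S.E_const_mul ((hX δ).lipschitz_comp ⟨L, hu⟩) hc, mul_assoc]
  gcongr

/-- A Lipschitz majorant of `f - f = 0` has nonnegative expectation. This keeps the infimum of the
rates of `f` finite. -/
lemma HasRate.add_nonneg (hX : ∀ t, IsRandomVector S (X t)) {f : V → ℝ} {K K' : ℝ}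
    (hf : HasRate S X f K) (hg : HasRate S X (-f) K') : 0 ≤ K + K' := by
  obtain ⟨u, ⟨L, hu⟩, hle, hE⟩ := hf.add hX hg
  obtain ⟨δ, h1, h2⟩ := (hE.and self_mem_nhdsWithin).exists
  have h3 := S.E_nonneg ((hX δ).lipschitz_comp ⟨L, hu⟩) fun ω => by simpa using hle (X δ ω)
  exact nonneg_of_mul_nonneg_left (h3.trans h1) (by exact_mod_cast h2)

/-- The functions whose expectations are of order `δ` from both sides. -/
def rateSubmodule (hX : ∀ t, IsRandomVector S (X t)) : Submodule ℝ (V → ℝ) where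
  carrier := {f | (∃ K, HasRate S X f K) ∧ ∃ K, HasRate S X (-f) K}
  zero_mem' := ⟨⟨0, HasRate.zero⟩, ⟨0, by simpa using HasRate.zero⟩⟩
  add_mem' := by
    rintro f g ⟨⟨a, ha⟩, ⟨b, hb⟩⟩ ⟨⟨a', ha'⟩, ⟨b', hb'⟩⟩
    exact ⟨⟨_, ha.add hX ha'⟩, ⟨_, by rw [neg_add]; exact hb.add hX hb'⟩⟩
  smul_mem' := by
    rintro c f ⟨⟨a, ha⟩, ⟨b, hb⟩⟩
    rcases le_total 0 c with hc | hc
    · exact ⟨⟨_, ha.smul hX hc⟩, ⟨_, by rw [← smul_neg]; exact hb.smul hX hc⟩⟩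
    · refine ⟨⟨_, by rw [← neg_smul_neg]; exact hb.smul hX (neg_nonneg.2 hc)⟩, ⟨_, by rw [← neg_smul]; exact ha.smul hX (neg_nonneg.2 hc)⟩⟩

lemma mem_rateSubmodule_of_abs_le (hX : ∀ t, IsRandomVector S (X t)) {f g : V → ℝ} {K : ℝ}
    (hg : HasRate S X g K) (h : ∀ z, |f z| ≤ g z) : f ∈ rateSubmodule hX :=
  ⟨⟨K, hg.mono fun z => (le_abs_self _).trans (h z)⟩,
    ⟨K, hg.mono fun z => (neg_le_abs _).trans (h z)⟩⟩

/-- Hahn-Banach: the upper rate of a function with a rate is attained by a linear functional. -/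
lemma exists_linearMap_le_rate (hX : ∀ t, IsRandomVector S (X t)) {f₀ : V → ℝ}
    (hf₀ : ∃ L : ℝ≥0, LipschitzWith L f₀) (hmem : f₀ ∈ rateSubmodule hX) {g : ℝ}
    (hg : Tendsto (fun δ : ℝ≥0 => S.E (fun ω => f₀ (X δ ω)) / (δ : ℝ)) (𝓝[>] 0) (𝓝 g)) :
    ∃ F : (V → ℝ) →ₗ[ℝ] ℝ,
      (∀ f ∈ rateSubmodule hX, ∀ K, HasRate S X f K → F f ≤ K) ∧ F f₀ = g := by
  have hfm (δ : ℝ≥0) := (hX δ).lipschitz_comp hf₀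
  -- This is domination on the line through `f₀`. For negative `c` it uses `E[c f₀] ≥ c E[f₀]`, a
  -- consequence of subadditivity.
  have key (c K : ℝ) (h : HasRate S X (c • f₀) K) : c * g ≤ K := by
    obtain ⟨u, hu, hle, hE⟩ := h
    refine le_of_tendsto (hg.const_mul c) ?_
    filter_upwards [hE, self_mem_nhdsWithin] with δ h1 h2
    have hδ : (0 : ℝ) < δ := by exact_mod_cast h2
    rw [← mul_div_assoc, div_le_iff₀ hδ]
    refine le_trans ?_ h1
    have h3 : S.E (fun ω => c * f₀ (X δ ω)) ≤ S.E (fun ω => u (X δ ω)) :=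
      S.mono _ ((hX δ).lipschitz_comp hu) _ (S.H.smul_mem c (hfm δ)) fun ω => hle _
    refine le_trans ?_ h3
    rcases le_total 0 c with hc | hc
    · rw [S.E_const_mul (hfm δ) hc]
    · have h4 := S.neg_E_neg_le (S.H.smul_mem c (hfm δ))
      have h5 : (fun ω => -(c • fun ω => f₀ (X δ ω)) ω) = fun ω => (-c) * f₀ (X δ ω) := by
        funext ω; simp
      rw [h5, S.E_const_mul (hfm δ) (neg_nonneg.2 hc)] at h4
      have h6 : S.E (c • fun ω => f₀ (X δ ω)) = S.E (fun ω => c * f₀ (X δ ω)) := rfl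
      linarith
  let N : rateSubmodule hX → ℝ := fun f => sInf {K | HasRate S X f K}
  have hne (f : rateSubmodule hX) : {K | HasRate S X f K}.Nonempty := f.2.1
  have hbdd (f : rateSubmodule hX) : BddBelow {K | HasRate S X f K} := by
    obtain ⟨K', h'⟩ := f.2.2
    exact ⟨-K', fun K hK => by linarith [HasRate.add_nonneg hX hK h']⟩
  have H (c : ℝ) (hc : c • (⟨f₀, hmem⟩ : rateSubmodule hX) = 0) : RingHom.id ℝ c • g = 0 := by
    have hc' : c • f₀ = 0 := congrArg Subtype.val hc
    apply le_antisymm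
    · exact key c 0 (by rw [hc']; exact HasRate.zero)
    · have := key (-c) 0 (by rw [neg_smul, hc', neg_zero]; exact HasRate.zero)
      rw [smul_eq_mul, RingHom.id_apply]
      linarith
  let F₀ : rateSubmodule hX →ₗ.[ℝ] ℝ := LinearPMap.mkSpanSingleton' ⟨f₀, hmem⟩ g H
  have N_hom : ∀ c : ℝ, 0 < c → ∀ f, N (c • f) = c * N f := by
    have hle (c : ℝ) (hc : 0 < c) (f : rateSubmodule hX) : N (c • f) ≤ c * N f := by
      rw [← div_le_iff₀' hc]
      refine le_csInf (hne f) fun K hK => ?_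
      rw [div_le_iff₀' hc]
      exact csInf_le (hbdd _) (hK.smul hX hc.le)
    intro c hc f
    refine le_antisymm (hle c hc f) ?_
    have := hle c⁻¹ (inv_pos.2 hc) (c • f)
    rw [inv_smul_smul₀ hc.ne', ← div_eq_inv_mul, le_div_iff₀ hc] at this
    linarith
  have N_add : ∀ f f', N (f + f') ≤ N f + N f' := by
    intro f f'
    rw [← sub_le_iff_le_add']
    refine le_csInf (hne f') fun K' hK' => ?_
    rw [sub_le_comm]
    refine le_csInf (hne f) fun K hK => ?_
    rw [sub_le_iff_le_add]
    exact csInf_le (hbdd _) (hK.add hX hK')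
  have N_le : ∀ x : F₀.domain, F₀ x ≤ N x := by
    rintro ⟨x, hx⟩
    obtain ⟨c, rfl⟩ := Submodule.mem_span_singleton.1 hx
    refine le_csInf (hne _) fun K hK => ?_
    have := LinearPMap.mkSpanSingleton'_apply (R := ℝ)
        (⟨f₀, hmem⟩ : rateSubmodule hX) g H c hx
    refine (le_of_eq this).trans ?_
    exact key c K hK
  obtain ⟨F₁, h1, h2⟩ := exists_extension_of_le_sublinear F₀ N N_hom N_add N_le
  -- A purely algebraic extension to all functions, which spares membership proofs in later
  -- formulas; the bounds hold on the submodule only.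
  obtain ⟨F, hF⟩ := F₁.exists_extend
  have hF' (f : rateSubmodule hX) : F f = F₁ f := by rw [← hF]; rfl
  refine ⟨F, fun f hf K hK => ?_, ?_⟩
  · rw [hF' ⟨f, hf⟩]
    exact (h2 _).trans (csInf_le (hbdd ⟨f, hf⟩) hK)
  · rw [hF' ⟨f₀, hmem⟩]
    have hd : (⟨f₀, hmem⟩ : rateSubmodule hX) ∈ F₀.domain :=
      Submodule.mem_span_singleton_self _
    rw [h1 ⟨_, hd⟩]
    have := LinearPMap.mkSpanSingleton'_apply_self (R := ℝ)
      (⟨f₀, hmem⟩ : rateSubmodule hX) g H hd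
    exact this

end Rate

/-! ### The Lévy measure from the Riesz representation theorem. -/

section Representation

/-- The weight `|z|² ∧ 1`. -/
noncomputable def weight {V : Type*} [NormedAddCommGroup V] (z : V) : ℝ := min ‖z‖ 1 ^ 2

variable {V : Type*} [NormedAddCommGroup V]

lemma min_norm_one_nonneg (z : V) : 0 ≤ min ‖z‖ 1 := le_min (norm_nonneg z) zero_le_one

lemma weight_nonneg (z : V) : 0 ≤ weight z := sq_nonneg _

lemma weight_le_one (z : V) : weight z ≤ 1 :=
  pow_le_one₀ (min_norm_one_nonneg z) (min_le_right _ _)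

lemma weight_pos {z : V} (hz : z ≠ 0) : 0 < weight z :=
  pow_pos (lt_min (norm_pos_iff.2 hz) one_pos) 2

lemma continuous_weight : Continuous (weight : V → ℝ) :=
  (continuous_norm.min continuous_const).pow 2

/-- The truncation `1 ∧ (n + 3 - |z|)⁺`. -/
noncomputable def cutoff (n : ℕ) (z : V) : ℝ := max 0 (min 1 (n + 3 - ‖z‖))

lemma cutoff_nonneg (n : ℕ) (z : V) : 0 ≤ cutoff n z := le_max_left _ _

lemma cutoff_le_one (n : ℕ) (z : V) : cutoff n z ≤ 1 := max_le zero_le_one (min_le_left _ _)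

lemma continuous_cutoff (n : ℕ) : Continuous (cutoff n : V → ℝ) :=
  continuous_const.max (continuous_const.min (continuous_const.sub continuous_norm))

lemma cutoff_eq_one {n : ℕ} {z : V} (h : ‖z‖ ≤ n + 2) : cutoff n z = 1 := by
  rw [cutoff, min_eq_left (by linarith), max_eq_right zero_le_one]

lemma hasCompactSupport_cutoff [NormedSpace ℝ V] [FiniteDimensional ℝ V] (n : ℕ) : HasCompactSupport (cutoff n : V → ℝ) := by
  refine HasCompactSupport.intro (isCompact_closedBall (0 : V) (n + 3)) fun z hz => ?_
  have hz' : (n : ℝ) + 3 < ‖z‖ := by simpa using hz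
  exact max_eq_left ((min_le_right _ _).trans (by linarith))

/-- A positive linear functional `F` on a solid space `M` of functions, controlled by the functions
`|z|² ∧ 1` at zero and `(|z| - ε)⁺` at infinity. -/
structure IsLevyFunctional (M : Submodule ℝ (V → ℝ)) (F : (V → ℝ) →ₗ[ℝ] ℝ) (K : ℝ) : Prop where
  solid : ∀ f g : V → ℝ, g ∈ M → (∀ z, |f z| ≤ g z) → f ∈ M
  nonneg : ∀ f ∈ M, (∀ z, 0 ≤ f z) → 0 ≤ F f
  weight_mem : weight ∈ M
  weight_le : F weight ≤ K
  trunc_mem : ∀ ε : ℝ, 0 < ε → (fun z => max (‖z‖ - ε) 0) ∈ M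
  trunc_le : ∀ ε : ℝ, 0 < ε → F (fun z => max (‖z‖ - ε) 0) ≤ K

namespace IsLevyFunctional

variable {M : Submodule ℝ (V → ℝ)} {F : (V → ℝ) →ₗ[ℝ] ℝ} {K : ℝ}

lemma mono (h : IsLevyFunctional M F K) {f g : V → ℝ} (hf : f ∈ M) (hg : g ∈ M)
    (hle : ∀ z, f z ≤ g z) : F f ≤ F g := by
  have := h.nonneg (g - f) (M.sub_mem hg hf) fun z => sub_nonneg.2 (hle z)
  rw [map_sub] at this
  linarith

lemma abs_le_of_le (h : IsLevyFunctional M F K) {f g : V → ℝ} {c : ℝ} (hg : g ∈ M) (hc : 0 ≤ c)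
    (hgK : F g ≤ K) (hle : ∀ z, |f z| ≤ c * g z) : f ∈ M ∧ |F f| ≤ c * K := by
  have hcg : (fun z => c * g z) ∈ M := M.smul_mem c hg
  have hf := h.solid f _ hcg hle
  have hF : F (fun z => c * g z) = c * F g := F.map_smul c g
  have h1 := h.mono hf hcg fun z => (le_abs_self _).trans (hle z)
  have h2 := h.mono (M.neg_mem hf) hcg fun z => (neg_le_abs _).trans (hle z)
  rw [map_neg] at h2
  have h3 : c * F g ≤ c * K := by gcongr
  exact ⟨hf, abs_le.2 ⟨by linarith, by linarith⟩⟩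

lemma const_nonneg (h : IsLevyFunctional M F K) : 0 ≤ K :=
  (h.nonneg _ h.weight_mem weight_nonneg).trans h.weight_le

variable [MeasurableSpace V] [BorelSpace V]

/-- Fatou's lemma for truncations that vanish near `0`, so that `v` represents `F` on them, and that
lie below `(|z| - ε)⁺`, whose value under `F` is at most `K` uniformly in `ε`. -/
lemma lintegral_enorm_le (h : IsLevyFunctional M F K) {v : Measure V}
    (hv : ∀ (r : V → ℝ) (C : ℝ), Continuous r →
      (∀ z, |r z| ≤ C * min ‖z‖ 1 ^ 3) → Integrable r v ∧ ∫ z, r z ∂v = F r) :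
    ∫⁻ z, ‖z‖ₑ ∂v ≤ ENNReal.ofReal K := by
  let r (n : ℕ) (z : V) : ℝ := min (n : ℝ) (max (‖z‖ - 1 / ((n : ℝ) + 1)) 0)
  have hr0 (n : ℕ) (z : V) : 0 ≤ r n z := le_min (Nat.cast_nonneg n) (le_max_right _ _)
  have hrc (n : ℕ) : Continuous (r n) := by fun_prop
  have hrb (n : ℕ) (z : V) : |r n z| ≤ n * ((n : ℝ) + 1) ^ 3 * min ‖z‖ 1 ^ 3 := by
    rw [abs_of_nonneg (hr0 n z)]
    have hm := min_norm_one_nonneg z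
    rcases le_or_gt ‖z‖ (1 / ((n : ℝ) + 1)) with hz | hz
    · have : r n z = 0 := by
        simp only [r]
        rw [max_eq_right (by linarith), min_eq_right (Nat.cast_nonneg n)]
      rw [this]
      positivity
    · have h1 : 1 / ((n : ℝ) + 1) ≤ min ‖z‖ 1 := by
        refine le_min hz.le ?_
        rw [div_le_one (by positivity)]
        linarith [(Nat.cast_nonneg n : (0 : ℝ) ≤ n)]
      have h2 : 1 ≤ ((n : ℝ) + 1) * min ‖z‖ 1 := by
        rwa [div_le_iff₀' (by positivity)] at h1
      calc r n z ≤ n * 1 := by rw [mul_one]; exact min_le_left _ _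
        _ ≤ n * (((n : ℝ) + 1) * min ‖z‖ 1) ^ 3 := by gcongr; exact one_le_pow₀ h2
        _ = _ := by ring
  have hlim (z : V) : Tendsto (fun n => ENNReal.ofReal (r n z)) atTop (𝓝 ‖z‖ₑ) := by
    rw [← ofReal_norm]
    refine ENNReal.tendsto_ofReal ?_
    have h1 : Tendsto (fun n : ℕ => max (‖z‖ - 1 / ((n : ℝ) + 1)) 0) atTop (𝓝 ‖z‖) := by
      have := (tendsto_one_div_add_atTop_nhds_zero_nat (𝕜 := ℝ)).const_sub ‖z‖
      simpa using this.max (tendsto_const_nhds (x := (0 : ℝ)))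
    refine h1.congr' ?_
    filter_upwards [eventually_ge_atTop ⌈‖z‖⌉₊] with n hn
    have h2 : ‖z‖ ≤ n := (Nat.le_ceil _).trans (by exact_mod_cast hn)
    refine (min_eq_right (max_le ?_ (Nat.cast_nonneg n))).symm
    have : 0 ≤ 1 / ((n : ℝ) + 1) := by positivity
    linarith
  have hle (n : ℕ) : ∫⁻ z, ENNReal.ofReal (r n z) ∂v ≤ ENNReal.ofReal K := by
    obtain ⟨h1, h2⟩ := hv (r n) _ (hrc n) (hrb n)
    rw [← ofReal_integral_eq_lintegral_ofReal h1 (ae_of_all _ (hr0 n)), h2]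
    refine ENNReal.ofReal_le_ofReal ?_
    have hε : (0 : ℝ) < 1 / ((n : ℝ) + 1) := by positivity
    refine (h.mono ?_ (h.trunc_mem _ hε) fun z => min_le_right _ _).trans (h.trunc_le _ hε)
    exact h.solid _ _ (h.trunc_mem _ hε) fun z => by
      rw [abs_of_nonneg (hr0 n z)]; exact min_le_right _ _
  calc ∫⁻ z, ‖z‖ₑ ∂v = ∫⁻ z, liminf (fun n => ENNReal.ofReal (r n z)) atTop ∂v :=
        lintegral_congr fun z => (hlim z).liminf_eq.symm
    _ ≤ liminf (fun n => ∫⁻ z, ENNReal.ofReal (r n z) ∂v) atTop :=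
        lintegral_liminf_le fun n => (hrc n).measurable.ennreal_ofReal
    _ ≤ ENNReal.ofReal K := by
        refine (liminf_le_limsup).trans ?_
        exact limsup_le_of_le (h := Eventually.of_forall hle)

variable [NormedSpace ℝ V] [FiniteDimensional ℝ V]

/-- The weight brings every bounded function into `M`. Riesz' theorem covers compactly supported
`g`; bounded `g` follow because the control of `(|z| - 1)⁺` prevents mass from escaping to infinity.
-/
lemma exists_finite_measure (h : IsLevyFunctional M F K) :
    ∃ μ : Measure V, IsFiniteMeasure μ ∧ ∀ (g : V → ℝ) (C : ℝ), Continuous g →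
      (∀ z, |g z| ≤ C) → ∫ z, g z ∂μ = F (fun z => weight z * g z) := by
  have hmem {g : V → ℝ} {C : ℝ} (hC : ∀ z, |g z| ≤ C) : (fun z => weight z * g z) ∈ M := by
    refine h.solid _ (C • weight) (M.smul_mem C h.weight_mem) fun z => ?_
    rw [abs_mul, abs_of_nonneg (weight_nonneg z), Pi.smul_apply, smul_eq_mul, mul_comm]
    exact mul_le_mul_of_nonneg_right (hC z) (weight_nonneg z)
  have hbdd (g : CompactlySupportedContinuousMap V ℝ) : ∃ C, ∀ z, |g z| ≤ C := by
    obtain ⟨C, hC⟩ := g.hasCompactSupport.exists_bound_of_continuous (map_continuous g)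
    exact ⟨C, hC⟩
  let Λ₀ : CompactlySupportedContinuousMap V ℝ →ₗ[ℝ] ℝ :=
    { toFun := fun g => F (fun z => weight z * g z)
      map_add' := fun g g' => by
        rw [← map_add]
        congr 1
        funext z
        simp [mul_add]
      map_smul' := fun c g => by
        rw [← map_smul]
        congr 1
        funext z
        simp [mul_left_comm] }
  let Λ : CompactlySupportedContinuousMap V ℝ →ₚ[ℝ] ℝ := PositiveLinearMap.mk₀ Λ₀ fun g hg => by
    obtain ⟨C, hC⟩ := hbdd g
    exact h.nonneg _ (hmem hC) fun z => mul_nonneg (weight_nonneg z) (hg z)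
  have hΛ (g : CompactlySupportedContinuousMap V ℝ) : Λ g = F (fun z => weight z * g z) := rfl
  let χ (n : ℕ) : CompactlySupportedContinuousMap V ℝ :=
    ⟨⟨cutoff n, continuous_cutoff n⟩, hasCompactSupport_cutoff n⟩
  have hχ (n : ℕ) (z : V) : χ n z = cutoff n z := rfl
  set μ := RealRMK.rieszMeasure Λ with hμ
  have hball (n : ℕ) : μ (Metric.closedBall 0 n) ≤ ENNReal.ofReal K := by
    refine (RealRMK.rieszMeasure_le_of_eq_one Λ (f := χ n) (fun z => cutoff_nonneg n z)
      (isCompact_closedBall 0 (n : ℝ)) fun z hz => ?_).trans (ENNReal.ofReal_le_ofReal ?_)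
    · exact cutoff_eq_one (by
        have : ‖z‖ ≤ n := by simpa using hz
        linarith)
    · rw [hΛ]
      refine (h.mono (hmem (C := 1) fun z => ?_) h.weight_mem fun z => ?_).trans h.weight_le
      · rw [hχ, abs_of_nonneg (cutoff_nonneg n z)]
        exact cutoff_le_one n z
      · exact mul_le_of_le_one_right (weight_nonneg z) (cutoff_le_one n z)
  have huniv : μ Set.univ ≤ ENNReal.ofReal K := by
    rw [← Metric.iUnion_closedBall_nat (0 : V), Monotone.measure_iUnion]
    · exact iSup_le hball
    · exact fun m n hmn => Metric.closedBall_subset_closedBall (by exact_mod_cast hmn)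
  have hfin : IsFiniteMeasure μ := ⟨huniv.trans_lt ENNReal.ofReal_lt_top⟩
  refine ⟨μ, hfin, fun g C hg hC => ?_⟩
  have hC0 : 0 ≤ C := (abs_nonneg _).trans (hC 0)
  let gχ (n : ℕ) : CompactlySupportedContinuousMap V ℝ :=
    ⟨⟨fun z => g z * cutoff n z, hg.mul (continuous_cutoff n)⟩,
      (hasCompactSupport_cutoff n).mul_left⟩
  have hint (n : ℕ) : ∫ z, g z * cutoff n z ∂μ = F (fun z => weight z * (g z * cutoff n z)) :=
    RealRMK.integral_rieszMeasure Λ (gχ n)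
  have lim1 : Tendsto (fun n : ℕ => ∫ z, g z * cutoff n z ∂μ) atTop (𝓝 (∫ z, g z ∂μ)) := by
    refine tendsto_integral_of_dominated_convergence (fun _ => C)
      (fun n => (hg.mul (continuous_cutoff n)).aestronglyMeasurable) (integrable_const C)
      (fun n => ae_of_all _ fun z => ?_) (ae_of_all _ fun z => ?_)
    · rw [Real.norm_eq_abs, abs_mul, abs_of_nonneg (cutoff_nonneg n z)]
      exact (mul_le_of_le_one_right (abs_nonneg _) (cutoff_le_one n z)).trans (hC z)
    · refine tendsto_const_nhds.congr' ?_
      filter_upwards [eventually_ge_atTop ⌈‖z‖⌉₊] with n hn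
      have : ‖z‖ ≤ n := (Nat.le_ceil _).trans (by exact_mod_cast hn)
      rw [cutoff_eq_one (by linarith), mul_one]
  have lim2 : Tendsto (fun n : ℕ => F (fun z => weight z * (g z * cutoff n z))) atTop
      (𝓝 (F fun z => weight z * g z)) := by
    have hz : Tendsto (fun n : ℕ => C * K * (1 / ((n : ℝ) + 1))) atTop (𝓝 0) := by
      simpa using tendsto_one_div_add_atTop_nhds_zero_nat.const_mul (C * K)
    rw [tendsto_iff_dist_tendsto_zero]
    refine squeeze_zero (fun _ => dist_nonneg) (fun n => ?_) hz
    rw [Real.dist_eq, ← map_sub]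
    refine (h.abs_le_of_le (h.trunc_mem 1 one_pos) (c := C * (1 / ((n : ℝ) + 1))) (by positivity)
      (h.trunc_le 1 one_pos) fun z => ?_).2.trans (le_of_eq (by ring))
    have hn : (0 : ℝ) < n + 1 := by positivity
    rcases le_or_gt ‖z‖ (n + 2) with hz | hz
    · simp only [Pi.sub_apply, cutoff_eq_one hz, mul_one, sub_self, abs_zero]
      positivity
    · have e : ((fun z => weight z * (g z * cutoff n z)) - fun z => weight z * g z) z =
          weight z * g z * (cutoff n z - 1) := by
        simp only [Pi.sub_apply]; ring
      rw [e, abs_mul, abs_mul, abs_of_nonneg (weight_nonneg z)]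
      have h1 : |cutoff n z - 1| ≤ 1 := by
        rw [abs_le]
        constructor <;> linarith [cutoff_nonneg n z, cutoff_le_one n z]
      -- The cutoff equals `1` up to radius `n + 2` precisely so that `‖z‖ - 1 ≥ n + 1` wherever it
      -- differs from `1`.
      have h2 : 1 ≤ 1 / ((n : ℝ) + 1) * max (‖z‖ - 1) 0 := by
        rw [one_div_mul_eq_div, le_div_iff₀ hn, max_eq_left (by linarith)]
        linarith
      calc weight z * |g z| * |cutoff n z - 1| ≤ 1 * C * 1 := by
            gcongr
            · exact weight_le_one z
            · exact hC z
        _ = C * 1 := by ring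
        _ ≤ C * (1 / ((n : ℝ) + 1) * max (‖z‖ - 1) 0) := by gcongr
        _ = _ := by ring
  refine tendsto_nhds_unique lim1 ?_
  simp_rw [hint]
  exact lim2

/-- The Lévy measure of a functional. -/
lemma exists_levyMeasure (h : IsLevyFunctional M F K) :
    ∃ v : Measure V, v {0} = 0 ∧ ∀ (r : V → ℝ) (C : ℝ), Continuous r →
      (∀ z, |r z| ≤ C * min ‖z‖ 1 ^ 3) → Integrable r v ∧ ∫ z, r z ∂v = F r := by
  obtain ⟨μ, hμ, hF⟩ := h.exists_finite_measure
  have hmeas : Measurable fun z : V => ENNReal.ofReal (1 / weight z) :=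
    (measurable_const.div continuous_weight.measurable).ennreal_ofReal
  have hlt : ∀ᵐ z ∂μ.restrict {0}ᶜ, ENNReal.ofReal (1 / weight z) < ∞ :=
    ae_of_all _ fun z => ENNReal.ofReal_lt_top
  -- The atom of `μ` at `0` is dropped. A test function of order `|z|³`, divided by the weight, is
  -- continuous and vanishes at `0`, so it does not see the atom.
  refine ⟨(μ.restrict {0}ᶜ).withDensity fun z => ENNReal.ofReal (1 / weight z), ?_,
    fun r C hr hC => ?_⟩
  · refine withDensity_absolutelyContinuous _ _ ?_
    rw [Measure.restrict_apply (measurableSet_singleton 0)]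
    simp
  · set g : V → ℝ := fun z => r z / weight z with hg
    have r0 : r 0 = 0 := by
      have := hC 0
      simpa using this
    have g0 : g 0 = 0 := by simp [hg, r0]
    have hgC (z : V) : |g z| ≤ C * min ‖z‖ 1 := by
      rcases eq_or_ne z 0 with rfl | hz
      · simp [g0]
      · simp only [hg]
        rw [abs_div, abs_of_pos (weight_pos hz), div_le_iff₀ (weight_pos hz)]
        refine (hC z).trans (le_of_eq ?_)
        rw [weight]; ring
    have hgC' (z : V) : |g z| ≤ |C| := by
      refine (hgC z).trans ?_
      calc C * min ‖z‖ 1 ≤ |C| * min ‖z‖ 1 := by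
            gcongr
            exact le_abs_self C
        _ ≤ |C| * 1 := by gcongr; exact min_le_right _ _
        _ = _ := mul_one _
    have hgc : Continuous g := by
      rw [continuous_iff_continuousAt]
      intro z
      rcases eq_or_ne z 0 with rfl | hz
      · rw [ContinuousAt, g0]
        refine squeeze_zero_norm hgC ?_
        have : Continuous fun z : V => C * min ‖z‖ 1 := by fun_prop
        simpa using this.tendsto 0
      · exact hr.continuousAt.div continuous_weight.continuousAt (weight_pos hz).ne'
    have hgr : (fun z => weight z * g z) = r := by
      funext z
      rcases eq_or_ne z 0 with rfl | hz
      · simp [g0, r0]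
      · exact mul_div_cancel₀ _ (weight_pos hz).ne'
    have hsmul : (fun z => (ENNReal.ofReal (1 / weight z)).toReal • r z) = g := by
      funext z
      rw [ENNReal.toReal_ofReal (one_div_nonneg.2 (weight_nonneg z)), smul_eq_mul,
        one_div_mul_eq_div]
    have hgi : Integrable g μ :=
      (integrable_const |C|).mono' hgc.aestronglyMeasurable (ae_of_all _ hgC')
    constructor
    · rw [integrable_withDensity_iff_integrable_smul' hmeas hlt, hsmul]
      exact hgi.restrict
    · rw [integral_withDensity_eq_integral_toReal_smul hmeas hlt, hsmul,
        setIntegral_eq_integral_of_forall_compl_eq_zero, hF g |C| hgc hgC', hgr]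
      intro z hz
      have : z = 0 := by simpa using hz
      rw [this]
      exact g0

end IsLevyFunctional

end Representation

section Matrices

open scoped MatrixOrder Matrix.Norms.L2Operator in
lemma exists_mul_transpose_of_posSemidef {d : ℕ} {A : Matrix (Fin d) (Fin d) ℝ}
    (hA : A.PosSemidef) : ∃ Q : Matrix (Fin d) (Fin d) ℝ, Q * Q.transpose = A := by
  obtain ⟨B, hB⟩ := CStarAlgebra.nonneg_iff_eq_star_mul_self.mp hA.nonneg
  refine ⟨B.transpose, ?_⟩
  rw [hB, Matrix.transpose_transpose, Matrix.star_eq_conjTranspose,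
    Matrix.conjTranspose_eq_transpose_of_trivial]

end Matrices

/-! ### Truncated second-order Taylor polynomials. -/

section Euclidean

variable {d : ℕ}

/-- The coordinate function truncated to `[-1, 1]`. -/
noncomputable def clip (i : Fin d) (z : EuclideanSpace ℝ (Fin d)) : ℝ := max (-1) (min 1 (z i))

lemma abs_clip_le (i : Fin d) (z : EuclideanSpace ℝ (Fin d)) : |clip i z| ≤ min ‖z‖ 1 := by
  have h := abs_le.1 (abs_apply_le_norm z i)
  have hz := norm_nonneg z
  refine le_min (abs_le.2 ⟨?_, ?_⟩) (abs_le.2 ⟨le_max_left _ _, ?_⟩)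
  · rcases le_total (-1 : ℝ) (-‖z‖) with h1 | h1
    · exact (le_min (by linarith) h.1).trans (le_max_right _ _)
    · exact h1.trans (le_max_left _ _)
  · exact max_le (by linarith) ((min_le_right _ _).trans h.2)
  · exact max_le (by norm_num) (min_le_left _ _)

lemma clip_eq {z : EuclideanSpace ℝ (Fin d)} (hz : ‖z‖ ≤ 1) (i : Fin d) : clip i z = z i := by
  have h := abs_le.1 ((abs_apply_le_norm z i).trans hz)
  rw [clip, min_eq_right h.2, max_eq_right h.1]

lemma continuous_clip (i : Fin d) : Continuous (clip i) := by
  unfold clip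
  fun_prop

/-- A polynomial of second order in the truncated coordinates. -/
noncomputable def clipPoly (c : Fin d → ℝ) (b : Fin d → Fin d → ℝ)
    (z : EuclideanSpace ℝ (Fin d)) : ℝ :=
  ∑ i, c i * clip i z + ∑ i, ∑ j, b i j * (clip i z * clip j z)

lemma continuous_clipPoly (c : Fin d → ℝ) (b : Fin d → Fin d → ℝ) :
    Continuous (clipPoly c b) := by
  have := continuous_clip (d := d)
  unfold clipPoly
  fun_prop

lemma abs_clipPoly_le (c : Fin d → ℝ) (b : Fin d → Fin d → ℝ) (z : EuclideanSpace ℝ (Fin d)) :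
    |clipPoly c b z| ≤ ∑ i, |c i| + ∑ i, ∑ j, |b i j| := by
  have h1 (i : Fin d) : |clip i z| ≤ 1 := (abs_clip_le i z).trans (min_le_right _ _)
  refine (abs_add_le _ _).trans (add_le_add ?_ ?_)
  · refine (Finset.abs_sum_le_sum_abs _ _).trans (Finset.sum_le_sum fun i _ => ?_)
    rw [abs_mul]
    exact mul_le_of_le_one_right (abs_nonneg _) (h1 i)
  · refine (Finset.abs_sum_le_sum_abs _ _).trans (Finset.sum_le_sum fun i _ =>
      (Finset.abs_sum_le_sum_abs _ _).trans (Finset.sum_le_sum fun j _ => ?_))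
    rw [abs_mul, abs_mul]
    exact mul_le_of_le_one_right (abs_nonneg _)
      (mul_le_one₀ (h1 i) (abs_nonneg _) (h1 j))

/-- The second-order Taylor polynomial of `f` at zero, in truncated coordinates. -/
noncomputable def clipTaylor (f : EuclideanSpace ℝ (Fin d) → ℝ) :
    EuclideanSpace ℝ (Fin d) → ℝ :=
  clipPoly (fun i => fderiv ℝ f 0 (EuclideanSpace.single i 1)) fun i j => hessian f 0 i j / 2

lemma clipTaylor_eq (f : EuclideanSpace ℝ (Fin d) → ℝ) {z : EuclideanSpace ℝ (Fin d)}
    (hz : ‖z‖ ≤ 1) :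
    clipTaylor f z = fderiv ℝ f 0 z + (1 / 2) * fderiv ℝ (fderiv ℝ f) 0 z z := by
  have h1 : fderiv ℝ (fderiv ℝ f) 0 z z =
      ∑ i, ∑ j, z i * z j * hessian f 0 i j := by
    have := apply_eq_sum ((ContinuousLinearMap.apply ℝ ℝ z).comp (fderiv ℝ (fderiv ℝ f) 0)) z
    simp only [ContinuousLinearMap.comp_apply, ContinuousLinearMap.apply_apply] at this
    rw [this]
    refine Finset.sum_congr rfl fun i _ => ?_
    rw [apply_eq_sum (fderiv ℝ (fderiv ℝ f) 0 (EuclideanSpace.single i 1)) z, Finset.mul_sum]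
    refine Finset.sum_congr rfl fun j _ => ?_
    rw [hessian, Matrix.of_apply, mul_assoc]
  rw [h1, apply_eq_sum (fderiv ℝ f 0) z, clipTaylor, clipPoly, Finset.mul_sum]
  congr 1
  · refine Finset.sum_congr rfl fun i _ => ?_
    rw [clip_eq hz, mul_comm]
  · refine Finset.sum_congr rfl fun i _ => ?_
    rw [Finset.mul_sum]
    refine Finset.sum_congr rfl fun j _ => ?_
    rw [clip_eq hz, clip_eq hz]
    ring

/-- By symmetry of the second derivative, `½ B(y, y)` has derivative `B y`. Subtracting it leaves a
function whose derivative varies by `O(|y|²)`, and `norm_taylor_one_le` with `k = 2` applies. -/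
lemma HasCbBound.abs_taylor_two_le {f : EuclideanSpace ℝ (Fin d) → ℝ} {L : ℝ}
    (hf : HasCbBound f L) (hf0 : f 0 = 0) (z : EuclideanSpace ℝ (Fin d)) :
    |f z - (fderiv ℝ f 0 z + (1 / 2) * fderiv ℝ (fderiv ℝ f) 0 z z)| ≤ L * ‖z‖ ^ 3 := by
  set B := fderiv ℝ (fderiv ℝ f) 0 with hB
  have hq (y : EuclideanSpace ℝ (Fin d)) :
      HasFDerivAt (fun y => (1 / 2 : ℝ) * B y y) (B y) y := by
    have h1 := ((B.hasFDerivAt (x := y)).clm_apply (hasFDerivAt_id y)).const_mul (1 / 2 : ℝ)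
    refine h1.congr_fderiv ?_
    ext w
    have hs : B w y = B y w := hf.isSymm.eq w y
    simp [hs]
    ring
  have hd (y : EuclideanSpace ℝ (Fin d)) :
      HasFDerivAt (fun y => f y - (1 / 2 : ℝ) * B y y) (fderiv ℝ f y - B y) y :=
    (hf.diff y).hasFDerivAt.sub (hq y)
  have key := norm_taylor_one_le (fun y => (hd y).differentiableAt) hf.nonneg (k := 2) (z := z)
    fun y _ => by
      rw [(hd y).fderiv, (hd 0).fderiv]
      have := norm_taylor_one_le hf.diff_fderiv hf.nonneg (k := 1) (z := y) fun w _ => by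
        simpa using hf.snd_lip w 0
      simpa [sub_right_comm] using this
  rw [(hd 0).fderiv, Real.norm_eq_abs] at key
  simp only [map_zero, hf0, mul_zero, sub_zero] at key
  convert key using 2
  ring

lemma HasCbBound.abs_sub_clipTaylor_le {f : EuclideanSpace ℝ (Fin d) → ℝ} {L : ℝ}
    (hf : HasCbBound f L) (hf0 : f 0 = 0) :
    ∃ C, ∀ z, |f z - clipTaylor f z| ≤ C * min ‖z‖ 1 ^ 3 := by
  have hb := abs_clipPoly_le (fun i => fderiv ℝ f 0 (EuclideanSpace.single i 1))
    fun i j => hessian f 0 i j / 2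
  set B := ∑ i, |fderiv ℝ f 0 (EuclideanSpace.single i 1)| + ∑ i, ∑ j, |hessian f 0 i j / 2|
  have hB : 0 ≤ B := (abs_nonneg _).trans (hb 0)
  refine ⟨L + B, fun z => ?_⟩
  rcases le_total ‖z‖ 1 with hz | hz
  · rw [clipTaylor_eq f hz, min_eq_left hz]
    refine (hf.abs_taylor_two_le hf0 z).trans ?_
    gcongr
    linarith
  · rw [min_eq_right hz, one_pow, mul_one]
    exact (abs_sub _ _).trans (add_le_add (hf.abs_le z) (hb z))

end Euclidean

/-! ### Drift and diffusion matrix of a Lévy functional. -/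

namespace IsLevyFunctional

variable {d : ℕ} {M : Submodule ℝ (EuclideanSpace ℝ (Fin d) → ℝ)}
  {F : (EuclideanSpace ℝ (Fin d) → ℝ) →ₗ[ℝ] ℝ} {K : ℝ}

lemma map_clipPoly (c : Fin d → ℝ) (b : Fin d → Fin d → ℝ) :
    F (clipPoly c b) = ∑ i, c i * F (clip i) +
      ∑ i, ∑ j, b i j * F (fun z => clip i z * clip j z) := by
  have : clipPoly c b = ∑ i, c i • clip i +
      ∑ i, ∑ j, b i j • (fun z => clip i z * clip j z) := by
    funext z
    simp [clipPoly, Finset.sum_apply]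
  rw [this]
  simp [map_sum]

lemma clip_mul_clip_mem (h : IsLevyFunctional M F K) (i j : Fin d) :
    (fun z => clip i z * clip j z) ∈ M :=
  h.solid _ _ h.weight_mem fun z => by
    rw [abs_mul, weight, sq]
    exact mul_le_mul (abs_clip_le i z) (abs_clip_le j z) (abs_nonneg _) (min_norm_one_nonneg z)

/-- The Lévy-Khintchine representation of a positive functional. -/
theorem exists_levyTriple (h : IsLevyFunctional M F K) (hclip : ∀ i, |F (clip i)| ≤ K) :
    ∃ u : LevyTriple d, u.size ≤ ENNReal.ofReal K + ENNReal.ofReal (d * (2 * K)) +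
        ENNReal.ofReal (d * K) ∧
      ∀ f : EuclideanSpace ℝ (Fin d) → ℝ, IsCb 3 f → f 0 = 0 → u.apply f = F f := by
  obtain ⟨v, hv0, hv⟩ := h.exists_levyMeasure
  have hK := h.const_nonneg
  have hlin := h.lintegral_enorm_le hv
  have hid : Integrable (fun z => ‖z‖) v := by
    refine ⟨continuous_norm.aestronglyMeasurable, ?_⟩
    simp only [HasFiniteIntegral, enorm_norm]
    exact hlin.trans_lt ENNReal.ofReal_lt_top
  have hidK : ∫ z, ‖z‖ ∂v ≤ K := by
    rw [integral_norm_eq_lintegral_enorm (f := fun z => z) continuous_id.aestronglyMeasurable]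
    exact ENNReal.toReal_le_of_le_ofReal hK hlin
  have hclipi (i : Fin d) : Integrable (clip i) v :=
    hid.mono' (continuous_clip i).aestronglyMeasurable
      (ae_of_all _ fun z => (abs_clip_le i z).trans (min_le_left _ _))
  have hclip2 (i j : Fin d) : Integrable (fun z => clip i z * clip j z) v := by
    refine hid.mono' ((continuous_clip i).mul (continuous_clip j)).aestronglyMeasurable
      (ae_of_all _ fun z => ?_)
    rw [norm_mul]
    calc ‖clip i z‖ * ‖clip j z‖ ≤ ‖z‖ * 1 :=
          mul_le_mul ((abs_clip_le i z).trans (min_le_left _ _))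
            ((abs_clip_le j z).trans (min_le_right _ _)) (norm_nonneg _) (norm_nonneg _)
      _ = _ := mul_one _
  have hpi (c : Fin d → ℝ) (b : Fin d → Fin d → ℝ) : Integrable (clipPoly c b) v :=
    (integrable_finsetSum _ fun i _ => (hclipi i).const_mul _).add
      (integrable_finsetSum _ fun i _ => integrable_finsetSum _ fun j _ =>
        (hclip2 i j).const_mul _)
  have hpint (c : Fin d → ℝ) (b : Fin d → Fin d → ℝ) : ∫ z, clipPoly c b z ∂v =
      ∑ i, c i * ∫ z, clip i z ∂v + ∑ i, ∑ j, b i j * ∫ z, clip i z * clip j z ∂v := by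
    unfold clipPoly
    rw [integral_add (integrable_finsetSum _ fun i _ => (hclipi i).const_mul _)
      (integrable_finsetSum _ fun i _ => integrable_finsetSum _ fun j _ =>
        (hclip2 i j).const_mul _), integral_finsetSum _ fun i _ => (hclipi i).const_mul _,
      integral_finsetSum _ fun i _ => integrable_finsetSum _ fun j _ =>
        (hclip2 i j).const_mul _]
    congr 1
    · exact Finset.sum_congr rfl fun i _ => integral_const_mul _ _
    · refine Finset.sum_congr rfl fun i _ => ?_
      rw [integral_finsetSum _ fun j _ => (hclip2 i j).const_mul _]
      exact Finset.sum_congr rfl fun j _ => integral_const_mul _ _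
  -- Drift and diffusion are the defects of `v` in representing `F` on truncated coordinates and
  -- their products.
  set q : Fin d → ℝ := fun i => F (clip i) - ∫ z, clip i z ∂v with hq
  set A : Matrix (Fin d) (Fin d) ℝ := Matrix.of fun i j =>
    F (fun z => clip i z * clip j z) - ∫ z, clip i z * clip j z ∂v with hA
  have hsub (c : Fin d → ℝ) (b : Fin d → Fin d → ℝ) :
      F (clipPoly c b) - ∫ z, clipPoly c b z ∂v = ∑ i, c i * q i + ∑ i, ∑ j, b i j * A i j := by
    rw [map_clipPoly, hpint]
    simp only [hq, hA, Matrix.of_apply, mul_sub, Finset.sum_sub_distrib]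
    ring
  have hAsymm : A.IsHermitian := by
    ext i j
    simp only [Matrix.conjTranspose_apply, star_trivial, hA, Matrix.of_apply, mul_comm]
  have hpsd : A.PosSemidef := by
    refine Matrix.PosSemidef.of_dotProduct_mulVec_nonneg hAsymm fun x => ?_
    set s : EuclideanSpace ℝ (Fin d) → ℝ := fun z => ∑ i, x i * clip i z with hs
    have hsq : (fun z => s z ^ 2) = clipPoly 0 fun i j => x i * x j := by
      funext z
      simp only [hs, clipPoly, Pi.zero_apply, zero_mul, Finset.sum_const_zero, zero_add, sq,
        Finset.sum_mul_sum]
      exact Finset.sum_congr rfl fun i _ => Finset.sum_congr rfl fun j _ => by ring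
    have hform : star x ⬝ᵥ A.mulVec x = F (fun z => s z ^ 2) - ∫ z, s z ^ 2 ∂v := by
      have h1 : ∫ z, s z ^ 2 ∂v = ∫ z, clipPoly 0 (fun i j => x i * x j) z ∂v := by rw [← hsq]
      rw [h1, hsq, hsub]
      simp only [dotProduct, Matrix.mulVec, Pi.star_apply, star_trivial, Pi.zero_apply, zero_mul,
        Finset.sum_const_zero, zero_add, Finset.mul_sum]
      exact Finset.sum_congr rfl fun i _ => Finset.sum_congr rfl fun j _ => by ring
    rw [hform, sub_nonneg]
    have hsc : Continuous s := by
      have := continuous_clip (d := d)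
      fun_prop
    set B := ∑ i, |x i| with hB
    have hB0 : 0 ≤ B := Finset.sum_nonneg fun i _ => abs_nonneg _
    have hsB (z : EuclideanSpace ℝ (Fin d)) : |s z| ≤ B * min ‖z‖ 1 := by
      refine (Finset.abs_sum_le_sum_abs _ _).trans ?_
      rw [hB, Finset.sum_mul]
      refine Finset.sum_le_sum fun i _ => ?_
      rw [abs_mul]
      gcongr
      exact abs_clip_le i z
    have hsB2 (z : EuclideanSpace ℝ (Fin d)) : s z ^ 2 ≤ B ^ 2 * weight z := by
      rw [weight, ← mul_pow, ← sq_abs]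
      gcongr
      exact hsB z
    have hsM : (fun z => s z ^ 2) ∈ M :=
      h.solid _ _ (M.smul_mem (B ^ 2) h.weight_mem) fun z => by
        rw [abs_of_nonneg (sq_nonneg _)]
        exact hsB2 z
    -- Multiplying by `κ n` makes `s²` of order `|z|³`, where `v` and `F` agree. Positivity then
    -- gives `∫ s² κ_n dv ≤ F(s²)`, and `κ_n ↑ 1` off the origin, where `s` vanishes.
    let κ (n : ℕ) (z : EuclideanSpace ℝ (Fin d)) : ℝ := min 1 (((n : ℝ) + 1) * ‖z‖)
    have hκ0 (n : ℕ) (z) : 0 ≤ κ n z := le_min zero_le_one (by positivity)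
    have hκ1 (n : ℕ) (z) : κ n z ≤ 1 := min_le_left _ _
    have hκc (n : ℕ) : Continuous (κ n) := by fun_prop
    have hrc (n : ℕ) : Continuous fun z => s z ^ 2 * κ n z := (hsc.pow 2).mul (hκc n)
    have hκb (n : ℕ) (z) : κ n z ≤ ((n : ℝ) + 1) * min ‖z‖ 1 := by
      have hn : (0 : ℝ) ≤ n := Nat.cast_nonneg n
      rcases le_total ‖z‖ 1 with hz | hz
      · rw [min_eq_left hz]; exact min_le_right _ _
      · rw [min_eq_right hz]; exact (hκ1 n z).trans (by linarith)
    have hrb (n : ℕ) (z) : |s z ^ 2 * κ n z| ≤ B ^ 2 * ((n : ℝ) + 1) * min ‖z‖ 1 ^ 3 := by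
      rw [abs_of_nonneg (mul_nonneg (sq_nonneg _) (hκ0 n z))]
      refine (mul_le_mul (hsB2 z) (hκb n z) (hκ0 n z)
        (mul_nonneg (sq_nonneg _) (weight_nonneg z))).trans (le_of_eq ?_)
      rw [weight]
      ring
    have hle (n : ℕ) : ∫ z, s z ^ 2 * κ n z ∂v ≤ F (fun z => s z ^ 2) := by
      rw [(hv _ _ (hrc n) (hrb n)).2]
      refine h.mono (h.solid _ _ hsM fun z => ?_) hsM fun z => ?_
      · rw [abs_of_nonneg (mul_nonneg (sq_nonneg _) (hκ0 n z))]
        exact mul_le_of_le_one_right (sq_nonneg _) (hκ1 n z)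
      · exact mul_le_of_le_one_right (sq_nonneg _) (hκ1 n z)
    refine le_of_tendsto' (tendsto_integral_of_dominated_convergence (fun z => s z ^ 2)
      (fun n => (hrc n).aestronglyMeasurable) (by rw [hsq]; exact hpi _ _)
      (fun n => ae_of_all _ fun z => ?_) (ae_of_all _ fun z => ?_)) hle
    · rw [Real.norm_eq_abs, abs_of_nonneg (mul_nonneg (sq_nonneg _) (hκ0 n z))]
      exact mul_le_of_le_one_right (sq_nonneg _) (hκ1 n z)
    · rcases eq_or_ne z 0 with rfl | hz
      · have : s 0 = 0 := by simpa using hsB 0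
        simp [this]
      · have hzp := norm_pos_iff.2 hz
        refine tendsto_const_nhds.congr' ?_
        filter_upwards [eventually_ge_atTop ⌈1 / ‖z‖⌉₊] with n hn
        have h1 : 1 / ‖z‖ ≤ n := (Nat.le_ceil _).trans (by exact_mod_cast hn)
        rw [div_le_iff₀ hzp] at h1
        have : κ n z = 1 := min_eq_left (by linarith)
        rw [this, mul_one]
  obtain ⟨Q, hQ⟩ := exists_mul_transpose_of_posSemidef hpsd
  refine ⟨⟨v, hv0, WithLp.toLp 2 q, Q⟩, ?_, fun f hf hf0 => ?_⟩
  · unfold LevyTriple.size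
    gcongr
    · rw [← ofReal_norm]
      refine ENNReal.ofReal_le_ofReal ?_
      have hqi (i : Fin d) : |q i| ≤ 2 * K := by
        have h1 : |∫ z, clip i z ∂v| ≤ K := by
          refine (abs_integral_le_integral_abs).trans (le_trans ?_ hidK)
          exact integral_mono (hclipi i).abs hid fun z =>
            (abs_clip_le i z).trans (min_le_left _ _)
        have := abs_sub (F (clip i)) (∫ z, clip i z ∂v)
        linarith [hclip i]
      calc ‖(WithLp.toLp 2 q : EuclideanSpace ℝ (Fin d))‖
          = ‖∑ i, EuclideanSpace.single i (q i)‖ := by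
            congr 1
            ext j
            simp [Finset.sum_apply]
        _ ≤ ∑ i, ‖EuclideanSpace.single i (q i)‖ := norm_sum_le _ _
        _ ≤ ∑ _i : Fin d, 2 * K := Finset.sum_le_sum fun i _ => by simpa using hqi i
        _ = d * (2 * K) := by simp
    · simp only [hQ]
      calc A.trace ≤ ∑ _i : Fin d, K := by
            refine Finset.sum_le_sum fun i _ => ?_
            simp only [Matrix.diag_apply, hA, Matrix.of_apply]
            have h1 : 0 ≤ ∫ z, clip i z * clip i z ∂v :=
              integral_nonneg fun z => mul_self_nonneg _
            have h2 : F (fun z => clip i z * clip i z) ≤ F weight :=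
              h.mono (h.clip_mul_clip_mem i i) h.weight_mem fun z => by
                rw [weight, sq, ← abs_mul_abs_self]
                exact mul_le_mul (abs_clip_le i z) (abs_clip_le i z) (abs_nonneg _)
                  (min_norm_one_nonneg z)
            linarith [h.weight_le]
        _ = d * K := by simp
  · obtain ⟨L, hL⟩ := hf.exists_bound
    obtain ⟨C, hC⟩ := hL.abs_sub_clipTaylor_le hf0
    have hcT : Continuous (clipTaylor f) := continuous_clipPoly _ _
    have hcr : Continuous fun z => f z - clipTaylor f z := hL.diff.continuous.sub hcT
    obtain ⟨i1, i2⟩ := hv _ C hcr hC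
    have hTi : Integrable (clipTaylor f) v := hpi _ _
    have hs := hsub (fun i => fderiv ℝ f 0 (EuclideanSpace.single i 1))
      fun i j => hessian f 0 i j / 2
    change F (clipTaylor f) - ∫ z, clipTaylor f z ∂v = _ at hs
    -- The remainder `f - clipTaylor f` is of order `|z|³ ∧ 1`, so `v` represents `F` on it exactly;
    -- the whole defect comes from the truncated Taylor polynomial.
    have hfi : ∫ z, f z ∂v = F f - F (clipTaylor f) + ∫ z, clipTaylor f z ∂v := by
      rw [← map_sub]
      have e : F (f - clipTaylor f) = ∫ z, (f z - clipTaylor f z) ∂v := i2.symm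
      rw [e, ← integral_add i1 hTi]
      simp
    have hin : inner ℝ (gradient f 0) (WithLp.toLp 2 q : EuclideanSpace ℝ (Fin d)) =
        ∑ i, fderiv ℝ f 0 (EuclideanSpace.single i 1) * q i := by
      rw [gradient, InnerProductSpace.toDual_symm_apply, apply_eq_sum]
      exact Finset.sum_congr rfl fun i _ => mul_comm _ _
    have htr : (1 / 2) * (hessian f 0 * A).trace =
        ∑ i, ∑ j, hessian f 0 i j / 2 * A i j := by
      simp only [Matrix.trace, Matrix.diag_apply, Matrix.mul_apply, Finset.mul_sum]
      refine Finset.sum_congr rfl fun i _ => Finset.sum_congr rfl fun j _ => ?_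
      have : A j i = A i j := hAsymm.apply i j
      rw [this]
      ring
    simp only [LevyTriple.apply]
    rw [hQ, htr, hin, hfi]
    linarith

end IsLevyFunctional

/-! ### Rates of the weight, the truncated coordinates and the tails. -/

lemma HasRate.mono_right {V : Type*} [NormedAddCommGroup V] {X : ℝ≥0 → Ω → V} {f : V → ℝ}
    {K K' : ℝ} (h : HasRate S X f K) (hK : K ≤ K') : HasRate S X f K' := by
  obtain ⟨g, hg, hle, hE⟩ := h
  refine ⟨g, hg, hle, hE.mono fun δ hδ => hδ.trans ?_⟩
  gcongr

lemma hasRate_of_forall_le {V : Type*} [NormedAddCommGroup V] {X : ℝ≥0 → Ω → V} {f : V → ℝ}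
    {K : ℝ} (hf : ∃ L : ℝ≥0, LipschitzWith L f) {t₀ : ℝ≥0} (ht₀ : 0 < t₀)
    (h : ∀ t ≤ t₀, S.E (fun ω => f (X t ω)) ≤ K * t) : HasRate S X f K :=
  ⟨f, hf, fun _ => le_rfl, by
    filter_upwards [Ioo_mem_nhdsGT ht₀] with t ht using h t ht.2.le⟩

lemma hasRate_of_tendsto {V : Type*} [NormedAddCommGroup V] {X : ℝ≥0 → Ω → V} {f : V → ℝ}
    {g K : ℝ} (hf : ∃ L : ℝ≥0, LipschitzWith L f)
    (hg : Tendsto (fun δ : ℝ≥0 => S.E (fun ω => f (X δ ω)) / (δ : ℝ)) (𝓝[>] 0) (𝓝 g))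
    (hK : g < K) : HasRate S X f K := by
  refine ⟨f, hf, fun _ => le_rfl, ?_⟩
  filter_upwards [hg.eventually (gt_mem_nhds hK), self_mem_nhdsWithin] with δ h1 h2
  have hδ : (0 : ℝ) < δ := by exact_mod_cast h2
  exact (div_le_iff₀ hδ).1 h1.le

lemma lipschitzWith_weight {V : Type*} [NormedAddCommGroup V] :
    LipschitzWith 2 (weight : V → ℝ) := by
  refine LipschitzWith.of_le_add_mul 2 fun x y => ?_
  have h1 : min ‖x‖ 1 ≤ min ‖y‖ 1 + dist x y := by
    have h2 : ‖x‖ ≤ ‖y‖ + dist x y := by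
      rw [dist_eq_norm]
      linarith [norm_sub_norm_le x y]
    have h3 := dist_nonneg (x := x) (y := y)
    rcases le_total ‖y‖ 1 with hy | hy
    · rw [min_eq_left hy]; exact (min_le_left _ _).trans h2
    · rw [min_eq_right hy]; exact (min_le_right _ _).trans (by linarith)
  have hx := min_norm_one_nonneg x
  have hy := min_norm_one_nonneg y
  have hx1 : min ‖x‖ 1 ≤ 1 := min_le_right _ _
  have hy1 : min ‖y‖ 1 ≤ 1 := min_le_right _ _
  have hd := dist_nonneg (x := x) (y := y)
  simp only [weight, NNReal.coe_ofNat]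
  rcases le_total (min ‖x‖ 1) (min ‖y‖ 1) with h | h
  · nlinarith
  · nlinarith

/-- With `a = min ‖x + y‖ 1`, either `a ≤ ‖x‖`, or `a² - ‖x‖² = (a - ‖x‖)(a + ‖x‖) ≤ 2 ‖y‖`. The
right-hand side has the form required by `exists_E_le`. -/
lemma weight_add_le {V : Type*} [NormedAddCommGroup V] (x y : V) :
    weight (x + y) ≤ ‖x‖ ^ 2 + 2 * ‖y‖ := by
  have h1 : min ‖x + y‖ 1 ≤ ‖x‖ + ‖y‖ := (min_le_left _ _).trans (norm_add_le x y)
  have h2 : min ‖x + y‖ 1 ≤ 1 := min_le_right _ _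
  have h3 := min_norm_one_nonneg (x + y)
  have hx := norm_nonneg x
  have hy := norm_nonneg y
  rw [weight]
  rcases le_total (min ‖x + y‖ 1) ‖x‖ with h | h
  · nlinarith
  · nlinarith

lemma lipschitzWith_clip {d : ℕ} (i : Fin d) : LipschitzWith 1 (clip i) := by
  refine LipschitzWith.of_le_add_mul 1 fun x y => ?_
  rw [NNReal.coe_one, one_mul, dist_eq_norm]
  have h := (abs_le.1 (abs_apply_le_norm (x - y) i)).2
  have hn := norm_nonneg (x - y)
  rw [PiLp.sub_apply] at h
  simp only [clip]
  refine max_le ?_ ?_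
  · exact (le_max_left (-1) _).trans (by linarith)
  · rcases le_total 1 (y i) with h1 | h1
    · rw [min_eq_left h1, max_eq_right (by norm_num)]
      exact (min_le_left _ _).trans (by linarith)
    · rw [min_eq_right h1]
      exact (min_le_right _ _).trans (by linarith [le_max_right (-1) (y i)])

lemma abs_clip_add_sub_le {d : ℕ} (i : Fin d) (x y : EuclideanSpace ℝ (Fin d)) :
    |clip i (x + y) - x i| ≤ ‖x‖ ^ 2 + ‖y‖ := by
  have h1 : |clip i (x + y) - clip i x| ≤ ‖y‖ := by
    simpa [Real.dist_eq, dist_eq_norm] using (lipschitzWith_clip i).dist_le_mul (x + y) x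
  have h2 : |clip i x - x i| ≤ ‖x‖ ^ 2 := by
    rcases le_total ‖x‖ 1 with hx | hx
    · rw [clip_eq hx, sub_self, abs_zero]
      positivity
    · have h3 := abs_le.1 (abs_apply_le_norm x i)
      have h4 : ‖x‖ ≤ ‖x‖ ^ 2 := by nlinarith
      refine le_trans ?_ h4
      rw [clip, abs_le]
      rcases le_total 1 (x i) with h | h
      · rw [min_eq_left h, max_eq_right (by norm_num)]
        constructor <;> linarith
      · rw [min_eq_right h]
        rcases le_total (-1) (x i) with h' | h'
        · rw [max_eq_right h']
          constructor <;> linarith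
        · rw [max_eq_left h']
          constructor <;> linarith
  have := abs_sub_le (clip i (x + y)) (clip i x) (x i)
  linarith

namespace IsLevyDecomposition

variable {d : ℕ} {Xc Xd : ℝ≥0 → Ω → EuclideanSpace ℝ (Fin d)}

/-- The point is that one `K` serves every `ε`: the inequality `(|x + y| - ε)⁺ ≤ ε⁻² |x|³ + |y|`
puts `ε` into the cubic coefficient, which does not affect the constant of `exists_E_le_of_cube`. -/
lemma exists_hasRate (h : IsLevyDecomposition S Xc Xd) :
    ∃ K, HasRate S (fun t ω => Xc t ω + Xd t ω) weight K ∧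
      (∀ i, HasRate S (fun t ω => Xc t ω + Xd t ω) (clip i) K ∧
        HasRate S (fun t ω => Xc t ω + Xd t ω) (-clip i) K) ∧
      ∀ ε : ℝ, 0 < ε → HasRate S (fun t ω => Xc t ω + Xd t ω) (fun z => max (‖z‖ - ε) 0) K := by
  obtain ⟨K₁, hK₁, t₁, ht₁, h1⟩ := h.exists_E_le
  obtain ⟨K₂, hK₂, h2⟩ := h.exists_E_le_of_cube
  have hle1 : K₁ * 3 ≤ K₁ * 3 + K₂ := by linarith
  have hle2 : K₂ ≤ K₁ * 3 + K₂ := by linarith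
  have hproj (i : Fin d) :
      ‖(EuclideanSpace.proj i : EuclideanSpace ℝ (Fin d) →L[ℝ] ℝ)‖ ≤ 1 :=
    ContinuousLinearMap.opNorm_le_bound _ zero_le_one fun x => by
      rw [one_mul]; exact abs_apply_le_norm x i
  refine ⟨K₁ * 3 + K₂, ?_, fun i => ⟨?_, ?_⟩, fun ε hε => ?_⟩
  · refine (hasRate_of_forall_le ⟨2, lipschitzWith_weight⟩ ht₁ fun t ht => ?_).mono_right hle1
    refine (h1 t ht (fun z => weight (z.1 + z.2)) 0 1 2
      (exists_lipschitz_comp_add ⟨2, lipschitzWith_weight⟩) zero_le_one zero_le_two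
      fun x y => ?_).trans (le_of_eq ?_)
    · simpa using weight_add_le x y
    · rw [norm_zero]; ring
  · refine (hasRate_of_forall_le ⟨1, lipschitzWith_clip i⟩ ht₁ fun t ht => ?_).mono_right hle1
    refine (h1 t ht (fun z => clip i (z.1 + z.2)) (EuclideanSpace.proj i) 1 1
      (exists_lipschitz_comp_add ⟨1, lipschitzWith_clip i⟩) zero_le_one zero_le_one
      fun x y => ?_).trans ?_
    · have := (abs_le.1 (abs_clip_add_sub_le i x y)).2
      simp only [PiLp.proj_apply]
      linarith
    · gcongr
      linarith [hproj i]
  · have hl : ∃ L : ℝ≥0, LipschitzWith L (-clip i) := ⟨1, (lipschitzWith_clip i).neg⟩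
    refine (hasRate_of_forall_le hl ht₁ fun t ht => ?_).mono_right hle1
    refine (h1 t ht (fun z => (-clip i) (z.1 + z.2)) (-EuclideanSpace.proj i) 1 1
      (exists_lipschitz_comp_add hl) zero_le_one zero_le_one fun x y => ?_).trans ?_
    · have := (abs_le.1 (abs_clip_add_sub_le i x y)).1
      simp only [PiLp.proj_apply, neg_apply, Pi.neg_apply]
      linarith
    · rw [norm_neg]
      gcongr
      linarith [hproj i]
  · have hl : ∃ L : ℝ≥0, LipschitzWith L
        (fun z : EuclideanSpace ℝ (Fin d) => max (‖z‖ - ε) 0) :=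
      ⟨_, (lipschitzWith_one_norm.sub (LipschitzWith.const ε)).max_const 0⟩
    obtain ⟨t₂, ht₂, h3⟩ := h2 (1 / ε ^ 2) (by positivity)
    refine (hasRate_of_forall_le hl ht₂ fun t ht => ?_).mono_right hle2
    refine h3 t ht (fun z => max (‖z.1 + z.2‖ - ε) 0) (exists_lipschitz_comp_add hl) fun x y => ?_
    have hx := norm_nonneg x
    have hy := norm_nonneg y
    have hxy := norm_add_le x y
    have h4 : 0 ≤ 1 / ε ^ 2 * ‖x‖ ^ 3 := by positivity
    refine max_le ?_ (by positivity)
    rcases le_total ‖x‖ ε with hxe | hxe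
    · linarith
    · have h5 : 1 ≤ 1 / ε ^ 2 * ‖x‖ ^ 2 := by
        rw [one_div_mul_eq_div, le_div_iff₀ (by positivity), one_mul]
        gcongr
      have h6 : 1 / ε ^ 2 * ‖x‖ ^ 3 = (1 / ε ^ 2 * ‖x‖ ^ 2) * ‖x‖ := by ring
      have h7 := mul_le_mul_of_nonneg_right h5 hx
      linarith

lemma mem_rateSubmodule (h : IsLevyDecomposition S Xc Xd)
    (hX : ∀ t, IsRandomVector S (fun ω => Xc t ω + Xd t ω))
    {f : EuclideanSpace ℝ (Fin d) → ℝ} {L : ℝ} (hf : HasCbBound f L) (hf0 : f 0 = 0) :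
    f ∈ rateSubmodule (X := fun t ω => Xc t ω + Xd t ω) hX := by
  obtain ⟨K, -, t₀, ht₀, hle⟩ := h.exists_E_le_of_fderiv
  obtain ⟨c, hc⟩ := exists_lipschitz_of_fderiv_le hf.diff hf.norm_fderiv_le
  refine ⟨⟨_, hasRate_of_forall_le ⟨c, hc⟩ ht₀ fun t ht =>
    hle t ht f L hf.diff hf.nonneg hf0 hf.norm_fderiv_le fun x => ?_⟩,
    ⟨_, hasRate_of_forall_le ⟨c, hc.neg⟩ ht₀ fun t ht =>
    hle t ht (-f) L hf.diff.neg hf.nonneg (by simp [hf0]) (fun x => ?_) fun x => ?_⟩⟩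
  · simpa using hf.fderiv_lip x 0
  · rw [fderiv_neg, norm_neg]
    exact hf.norm_fderiv_le x
  · rw [fderiv_neg, fderiv_neg, neg_sub_neg, norm_sub_rev]
    simpa using hf.fderiv_lip x 0

/-- A linear functional below the upper rate is a Lévy functional. -/
lemma isLevyFunctional {X : ℝ≥0 → Ω → EuclideanSpace ℝ (Fin d)}
    (hX : ∀ t, IsRandomVector S (X t)) {F : (EuclideanSpace ℝ (Fin d) → ℝ) →ₗ[ℝ] ℝ}
    (hF : ∀ f ∈ rateSubmodule hX, ∀ K, HasRate S X f K → F f ≤ K) {K : ℝ}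
    (hw : HasRate S X weight K)
    (ht : ∀ ε : ℝ, 0 < ε → HasRate S X (fun z => max (‖z‖ - ε) 0) K) :
    IsLevyFunctional (rateSubmodule hX) F K := by
  have hmem {f : EuclideanSpace ℝ (Fin d) → ℝ} (hf : HasRate S X f K) (h0 : ∀ z, 0 ≤ f z) :
      f ∈ rateSubmodule hX :=
    mem_rateSubmodule_of_abs_le hX hf fun z => (abs_of_nonneg (h0 z)).le
  refine ⟨fun f g hg hfg => ?_, fun f hf h0 => ?_, hmem hw weight_nonneg,
    hF _ (hmem hw weight_nonneg) _ hw, fun ε hε => hmem (ht ε hε) fun z => le_max_right _ _,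
    fun ε hε => hF _ (hmem (ht ε hε) fun z => le_max_right _ _) _ (ht ε hε)⟩
  · obtain ⟨K', hK'⟩ := hg.1
    exact mem_rateSubmodule_of_abs_le hX hK' hfg
  · have h1 : HasRate S X (-f) 0 := HasRate.zero.mono fun z => by simpa using h0 z
    have h2 := hF _ ((rateSubmodule hX).neg_mem hf) 0 h1
    rw [map_neg] at h2
    linarith

end IsLevyDecomposition

end GLevy

/-! ### The representing set and attainment of the supremum. -/

theorem mainTheorem1 {Ω : Type*} (S : GLevy.SublinearExpectationSpace Ω) (d : ℕ)
    (X : ℝ≥0 → Ω → EuclideanSpace ℝ (Fin d)) (hX : GLevy.IsGLevyProcess S X) :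
    ∃ U : Set (GLevy.LevyTriple d),
      (⨆ u ∈ U, u.size) < ∞ ∧
      ∀ f : EuclideanSpace ℝ (Fin d) → ℝ, GLevy.IsCb 3 f → f 0 = 0 →
        (∀ u ∈ U, Integrable f u.v) ∧
        ∃ g : ℝ,
          Tendsto (fun δ : ℝ≥0 => S.E (fun ω => f (X δ ω)) / (δ : ℝ)) (𝓝[>] 0) (𝓝 g) ∧
          IsLUB ((fun u : GLevy.LevyTriple d => u.apply f) '' U) g := by
  obtain ⟨hlevy, Xc, Xd, hsum, hZ, hcube, htend, hjump⟩ := hX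
  have hrv := hlevy.isRandomVector
  have h : GLevy.IsLevyDecomposition S Xc Xd := ⟨hZ, hcube, htend, hjump⟩
  obtain rfl : X = fun t ω => Xc t ω + Xd t ω := funext fun t => funext fun ω => hsum t ω
  obtain ⟨K, hw, hc, ht⟩ := h.exists_hasRate
  set B : ℝ≥0∞ := ENNReal.ofReal K + ENNReal.ofReal (d * (2 * K)) + ENNReal.ofReal (d * K) with hB
  have hBtop : B < ∞ := by
    rw [hB, ENNReal.add_lt_top, ENNReal.add_lt_top]
    exact ⟨⟨ENNReal.ofReal_lt_top, ENNReal.ofReal_lt_top⟩, ENNReal.ofReal_lt_top⟩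
  refine ⟨{u | u.size ≤ B ∧ ∀ f : EuclideanSpace ℝ (Fin d) → ℝ, GLevy.IsCb 3 f → f 0 = 0 →
    ∀ g : ℝ, Tendsto (fun δ : ℝ≥0 => S.E (fun ω => f (Xc δ ω + Xd δ ω)) / (δ : ℝ)) (𝓝[>] 0) (𝓝 g) →
      u.apply f ≤ g}, (iSup₂_le fun u hu => hu.1).trans_lt hBtop, fun f hf hf0 => ?_⟩
  obtain ⟨L, hL⟩ := hf.exists_bound
  refine ⟨fun u hu => ?_, ?_⟩
  · have hfin : ∫⁻ z, ‖z‖ₑ ∂u.v < ∞ :=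
      ((le_add_right (le_add_right le_rfl)).trans hu.1).trans_lt hBtop
    have hid : Integrable (fun z => z) u.v := ⟨continuous_id.aestronglyMeasurable, hfin⟩
    refine (hid.norm.const_mul L).mono' hL.diff.continuous.aestronglyMeasurable
      (ae_of_all _ fun z => ?_)
    have := convex_univ.norm_image_sub_le_of_norm_fderiv_le (𝕜 := ℝ) (fun x _ => hL.diff x)
      (fun x _ => hL.norm_fderiv_le x) (Set.mem_univ 0) (Set.mem_univ z)
    simpa [hf0] using this
  · obtain ⟨g, hg⟩ := h.exists_tendsto hL hf0
    refine ⟨g, hg, ?_, fun b hb => ?_⟩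
    · rintro _ ⟨u, hu, rfl⟩
      exact hu.2 f hf hf0 g hg
    -- The triple built from `F` lies in the set and takes the value `g` at `f`, so the supremum is
    -- attained.
    · obtain ⟨F, hF, hFg⟩ := GLevy.exists_linearMap_le_rate hrv
        (GLevy.exists_lipschitz_of_fderiv_le hL.diff hL.norm_fderiv_le)
        (h.mem_rateSubmodule hrv hL hf0) hg
      have hFL := GLevy.IsLevyDecomposition.isLevyFunctional hrv hF hw ht
      obtain ⟨u, hu, hu2⟩ := hFL.exists_levyTriple fun i => by
        have hm : GLevy.clip i ∈ GLevy.rateSubmodule hrv := ⟨⟨K, (hc i).1⟩, ⟨K, (hc i).2⟩⟩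
        have h1 := hF _ hm K (hc i).1
        have h2 := hF _ ((GLevy.rateSubmodule hrv).neg_mem hm) K (hc i).2
        rw [map_neg] at h2
        exact abs_le.2 ⟨by linarith, h1⟩
      refine hb ⟨u, ⟨hu, fun f' hf' hf'0 g' hg' => ?_⟩, (hu2 f hf hf0).trans hFg⟩
      obtain ⟨L', hL'⟩ := hf'.exists_bound
      rw [hu2 f' hf' hf'0]
      -- Convergence to `g'` provides a rate `K'` only for `K' > g'`.
      refine le_of_forall_gt_imp_ge_of_dense fun K' hK' => ?_
      exact hF f' (h.mem_rateSubmodule hrv hL' hf'0) K' (GLevy.hasRate_of_tendsto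
        (GLevy.exists_lipschitz_of_fderiv_le hL'.diff hL'.norm_fderiv_le) hg' hK')
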